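/- Let $n\ge 0$ and let $G=([n],E)$ be a (finite, simple, possibly disconnected) chordal graph whose vertices $1,2,\ldots,n$ form a perfect elimination ordering, i.e., every vertex $x$ induces a clique together with its neighbors $y<x$. An \emph{elimination tree} for a connected graph $H$ is a rooted (unordered) tree on the vertices of $H$ that consists of a root $x$ whose children are the roots of elimination trees, one for each connected component of $H-x$. An \emph{elimination forest} for $G$ is a set of elimination trees, one for each connected component of $G$; $\mathcal E(G)$ is the set of all of them. Let $F\in\mathcal E(G)$, let $i$ be the parent of $j$ in $F$, and let $H$ be the subgraph of $G$ induced by the vertices of the subtree of $F$ rooted at $i$. The \emph{rotation} of the edge $\{i,j\}$ makes $j$ the parent of $i$ and puts $j$ in the former place of $i$ (child of the former parent of $i$, or root); the other subtrees of $i$ remain subtrees of $i$; a subtree of $j$ remains a subtree of $j$ unless its vertices lie in the same connected component of $H-j$ as $i$, in which case it becomes a subtree of $i$. For an edge $\{i,j\}$ with $i<j$ this is called an \emph{up-rotation} of $j$ if $i$ is the parent of $j$, and a \emph{down-rotation} of $j$ if $i$ is a child of $j$. \emph{Algorithm R}, started from $F_0\in\mathcal E(G)$, first visits $F_0$. Then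 it repeats the following step: among the vertices $n,n-1,\ldots,1$, find the first vertex $j$ for which some up- or down-rotation of $j$ in the most recently visited forest creates an unvisited forest. If there is no such $j$, or if several such rotations of this vertex $j$ create unvisited forests, terminate; otherwise perform the unique such rotation and visit the resulting forest. Let $F_0$ be the elimination forest obtained by removing the vertices in increasing order $1,2,\ldots,n$. Then Algorithm R, started from $F_0$, terminates, having visited every elimination forest in $\mathcal E(G)$ exactly once (and nothing else), and any two consecutively visited forests differ by one tree rotation. Moreover, the sequence of visited forests is a Hamilton path on the graph associahedron of $G$, in the following sense. A \emph{tube} of $G$ is a nonempty set of vertices inducing a connected subgraph, and the graph associahedron is the polytope $\mathcal A(G)=\sum_{S \text{ tube of } G}\operatorname{conv}\{e_i\mid i\in S\}\subset\mathbb R^n$ (Minkowski sum). To $F\in\mathcal E(G)$ associate the point $v_F\in\mathbb R^n$ whose $i$th coordinate is the number of tubes $S$ that contain $i$ and consist of $i$ and descendants of $i$ in $F$. If $F_0,F_1,\ldots,F_N$ is the sequence of visited forests, then $v_{F_0},v_{F_1},\ldots,v_{F_N}$ contains every vertex of $\mathcal A(G)$ exactly once, and any two consecutive points are joined by an edge of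 $\mathcal A(G)$. -/

import Mathlib

/-! Vertices `1, …, n` of the paper are the elements `0, …, n - 1` of `Fin n`, in the same order. -/

namespace Elim

/-- The natural order of the vertices is a perfect elimination ordering of `G`: every vertex `x`
induces a clique together with its neighbours that come before `x`.
(A graph that has such an ordering is chordal.) -/
def IsPEO {n : ℕ} (G : SimpleGraph (Fin n)) : Prop :=
  ∀ x : Fin n, G.IsClique {y | y = x ∨ (y < x ∧ G.Adj x y)}

/-- A tube: a nonempty set of vertices that induces a connected subgraph
(`SimpleGraph.Connected` includes nonemptiness). -/
def IsTube {V : Type*} (G : SimpleGraph V) (S : Set V) : Prop :=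
  (G.induce S).Connected

/-- `C` is the vertex set of a connected component of the subgraph of `G` induced by `S`. -/
def IsComponent {V : Type*} (G : SimpleGraph V) (S C : Set V) : Prop :=
  Maximal (fun D => D ⊆ S ∧ IsTube G D) C

/-- Rooted forests on `V`, given by the parent of each vertex (`none` for a root). There is no
ordering among children or trees. Acyclicity is part of `IsElimForest`. -/
abbrev Forest (V : Type*) := V → Option V

/-- `IsElimTree G F S x`: the forest `F`, restricted to `S`, is an elimination tree with root `x`
for the connected graph induced by `S`. The root `x` has as children the roots `r C` of elimination
trees for the components `C` of the graph induced by `S \ {x}`. -/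
inductive IsElimTree {V : Type*} (G : SimpleGraph V) (F : Forest V) : Set V → V → Prop
  | node (S : Set V) (x : V) (r : Set V → V) (hS : IsTube G S) (hx : x ∈ S)
      (hpar : ∀ C, IsComponent G (S \ {x}) C → F (r C) = some x)
      (hsub : ∀ C, IsComponent G (S \ {x}) C → IsElimTree G F C (r C)) :
      IsElimTree G F S x

/-- An elimination forest for `G`: one elimination tree for each connected component of `G`. -/
def IsElimForest {V : Type*} (G : SimpleGraph V) (F : Forest V) : Prop :=
  ∀ C, IsComponent G Set.univ C → ∃ x, F x = none ∧ IsElimTree G F C x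

/-- The vertex set of the subtree of `F` rooted at `i`: the vertex `i` and all its descendants. -/
def subtree {V : Type*} (F : Forest V) (i : V) : Set V :=
  {v | Relation.ReflTransGen (fun a b => F a = some b) v i}

open Classical in
/-- The forest obtained from `F` by rotating the edge `{i, j}`, where `i` is the parent of `j`.
The vertex `j` takes the place of `i` and becomes the parent of `i`; the other subtrees of `i` stay
where they are; the subtree rooted at a child `v` of `j` remains below `j`, unless its vertices
belong to the same component of `H - j` as `i`, in which case it becomes a subtree of `i`. Here `H`
is the graph induced by the subtree of `F` rooted at `i`. -/
noncomputable def rotate {V : Type*} (G : SimpleGraph V) (F : Forest V) (i j : V) : Forest V :=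
  fun v =>
    if v = j then F i
    else if v = i then some j
    else if F v = some j ∧
        ∃ C, IsComponent G (subtree F i \ {j}) C ∧ i ∈ C ∧ subtree F v ⊆ C then some i
    else F v

/-- `F'` arises from `F` by one tree rotation. -/
def IsRotation {V : Type*} (G : SimpleGraph V) (F F' : Forest V) : Prop :=
  ∃ i j, F j = some i ∧ F' = rotate G F i j

/-- `{i, j}` is an edge of the forest `F`. -/
def IsEdge {V : Type*} (F : Forest V) (i j : V) : Prop :=
  F j = some i ∨ F i = some j

open Classical in
/-- Rotation of the edge `{i, j}` of `F`: this moves `j` up if `i` is the parent of `j`, and moves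
`j` down if `i` is a child of `j`. -/
noncomputable def rotateEdge {V : Type*} (G : SimpleGraph V) (F : Forest V) (i j : V) : Forest V :=
  if F j = some i then rotate G F i j else rotate G F j i

open Classical in
/-- The up- and down-rotations of the vertex `j` in `F` that create an unvisited forest, where
`visited` is the list of visited forests. Each is given by the other end `i < j` of the rotated
edge. -/
noncomputable def moves {n : ℕ} (G : SimpleGraph (Fin n)) (visited : List (Forest (Fin n)))
    (F : Forest (Fin n)) (j : Fin n) : List (Fin n) :=
  (List.finRange n).filter fun i => decide (i < j ∧ IsEdge F i j ∧ rotateEdge G F i j ∉ visited)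

/-- Step R2 of the greedy algorithm. The argument is the list of the forests visited so far, in the
order of the visits. Among the vertices, in decreasing order, find the first one that allows an up-
or down-rotation to an unvisited forest. If there is none, or if this vertex allows several such
rotations, the algorithm terminates (`none`); otherwise the result is the next forest to visit. -/
noncomputable def nextForest {n : ℕ} (G : SimpleGraph (Fin n))
    (visited : List (Forest (Fin n))) : Option (Forest (Fin n)) :=
  match visited.getLast? with
  | none => none
  | some F =>
    match (List.finRange n).reverse.find? (fun j => decide (moves G visited F j ≠ [])) with
    | none => none
    | some j =>
      match moves G visited F j with
      | [i] => some (rotateEdge G F i j)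
      | _ => none

/-- The list of forests that the greedy algorithm (Algorithm R), started from `F₀`, has visited
after `k` executions of step R2. It no longer changes once the algorithm has terminated. -/
noncomputable def algorithmR {n : ℕ} (G : SimpleGraph (Fin n)) (F₀ : Forest (Fin n)) :
    ℕ → List (Forest (Fin n))
  | 0 => [F₀]
  | k + 1 =>
    match nextForest G (algorithmR G F₀ k) with
    | none => algorithmR G F₀ k
    | some F => algorithmR G F₀ k ++ [F]

open Classical in
/-- The elimination forest obtained by removing the vertices in increasing order: when `u` is
removed, the vertices `w ≥ u` are present, and `u` becomes an ancestor of all other vertices `v` of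
its component at that time. The parent of `v` is the last removed, i.e. largest, such `u < v`. -/
noncomputable def initialForest {n : ℕ} (G : SimpleGraph (Fin n)) : Forest (Fin n) :=
  fun v => (List.finRange n).reverse.find? fun u =>
    decide (u < v ∧ ∃ C, IsComponent G {w | u ≤ w} C ∧ u ∈ C ∧ v ∈ C)

open Classical in
open scoped Pointwise in
/-- The graph associahedron of `G`: the Minkowski sum, over all tubes `S` of `G`, of the standard
simplices `conv {eᵢ | i ∈ S}`. -/
noncomputable def graphAssociahedron {n : ℕ} (G : SimpleGraph (Fin n)) : Set (Fin n → ℝ) :=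
  ∑ S ∈ (Finset.univ : Finset (Set (Fin n))).filter (fun S => IsTube G S),
    convexHull ℝ ((fun i : Fin n => (Pi.single i 1 : Fin n → ℝ)) '' S)

/-- The vertex of the graph associahedron that corresponds to the elimination forest `F`: its `i`th
coordinate is the number of tubes whose topmost vertex in `F` is `i`. -/
noncomputable def assocVertex {n : ℕ} (G : SimpleGraph (Fin n)) (F : Forest (Fin n)) :
    Fin n → ℝ :=
  fun i => (Set.ncard {S : Set (Fin n) | IsTube G S ∧ i ∈ S ∧ S ⊆ subtree F i} : ℝ)

/-- The skeleton of a polytope `P`: the graph on the vertices (extreme points) of `P` in which two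
distinct vertices are adjacent if the segment between them is a face of `P`. -/
def skeleton {E : Type*} [AddCommGroup E] [Module ℝ E] [TopologicalSpace E] (P : Set E) :
    SimpleGraph (P.extremePoints ℝ) where
  Adj x y := x ≠ y ∧ IsExposed ℝ P (segment ℝ (x : E) (y : E))
  symm := ⟨fun x y h => ⟨h.1.symm, segment_symm ℝ (x : E) (y : E) ▸ h.2⟩⟩
  loopless := ⟨fun _ h => h.1 rfl⟩

end Elim

namespace Elim

section Nesting

variable {V : Type*} {G : SimpleGraph V}

/-! ### Tubes and components -/

/-! An elimination forest is the same thing as its family of subtrees: a laminar family of tubes,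
one with top `v` for each vertex `v`, in which adjacent vertices are comparable (`IsNesting`,
`isElimForest_iff`). In this language, rotating `j` above its parent `i` changes only two sets: `j`
inherits the old set of `i`, and `i` keeps its component after deletion of `j` (`IsSwap`).

The Hamilton path comes from induction on `n`. The last vertex `z` is simplicial, so deleting `z`
from every subtree of a forest `F` leaves an elimination forest `F'` of the smaller graph.
Conversely, fix `F'`. The neighbours of `z` form a clique, so the vertices whose subtree contains
such a neighbour form a chain (`attachSet_chain`). The ancestors of `z` in `F` are a top segment of
this chain, and `F` is determined by their number (`eq_of_depth_eq`). Every number up to the length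
of the chain occurs (`exists_of_depth_le`), and a rotation of `z` changes it by one
(`Flips.restricts_last`). So the forests over `F'` form a path from `z` as a root to `z` as a leaf.
At either end, rotations of smaller vertices lift (`Flips.castSucc`). Sweeping `z` alternately up
and down while `F'` runs through the path of the smaller graph gives all forests
(`isGreedy_zigzag`).

The greedy rule takes exactly this route. Inside a sweep, one of the at most two rotations of `z`
leads back to a visited forest (`isGreedy_sweep`). At the end of a sweep every rotation of `z` leads
to a visited forest, and the rule acts as in the smaller graph (`IsStep.lift`).

For the polytope, a functional that decreases down `F` is maximal over each simplex at the top
vertex of the tube, hence over the sum at `assocVertex G F`. Every functional is compatible with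
some forest, so these points are all the vertices (`extremePoints_graphAssociahedron`). Giving equal
weight to the two ends of a rotated edge exposes an edge (`IsSwap.isExposed`). -/

lemma IsTube.nonempty {S : Set V} (h : IsTube G S) : S.Nonempty := by
  have := SimpleGraph.Connected.nonempty h
  exact Set.nonempty_coe_sort.1 this

lemma isTube_singleton (v : V) : IsTube G {v} := by
  have : Nonempty ({v} : Set V) := ⟨⟨v, rfl⟩⟩
  have : Subsingleton ({v} : Set V) := ⟨fun a b => Subtype.ext (a.2.trans b.2.symm)⟩
  exact ⟨SimpleGraph.Preconnected.of_subsingleton⟩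

lemma isTube_pair {u v : V} (h : G.Adj u v) : IsTube G {u, v} :=
  SimpleGraph.induce_pair_connected_of_adj h

lemma IsTube.union {S T : Set V} (hS : IsTube G S) (hT : IsTube G T) (h : (S ∩ T).Nonempty) :
    IsTube G (S ∪ T) :=
  SimpleGraph.induce_union_connected hS.preconnected hT.preconnected h

/-- A subset of a tube that is nonempty and closed under adjacency in the tube is all of it. -/
lemma IsTube.subset_of_closed {S A : Set V} (hS : IsTube G S) {a : V} (ha : a ∈ S) (hA : a ∈ A)
    (h : ∀ x y, x ∈ S → y ∈ S → G.Adj x y → x ∈ A → y ∈ A) : S ⊆ A := by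
  intro b hb
  obtain ⟨p⟩ := hS.preconnected ⟨a, ha⟩ ⟨b, hb⟩
  have key : ∀ (x y : S), (G.induce S).Walk x y → (x : V) ∈ A → (y : V) ∈ A := by
    intro x y p
    induction p with
    | nil => exact id
    | cons hadj _ ih => exact fun hx => ih (h _ _ (Subtype.prop _) (Subtype.prop _) hadj hx)
  exact key _ _ p hA

/-- The vertex set of the component of `u` in the graph induced by `S`. -/
def componentOf (G : SimpleGraph V) (S : Set V) (u : V) : Set V :=
  {v | ∃ D, D ⊆ S ∧ IsTube G D ∧ u ∈ D ∧ v ∈ D}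

lemma componentOf_subset (S : Set V) (u : V) : componentOf G S u ⊆ S :=
  fun _ ⟨_, hD, _, _, hv⟩ => hD hv

lemma mem_componentOf_self {S : Set V} {u : V} (h : u ∈ S) : u ∈ componentOf G S u :=
  ⟨{u}, by simpa using h, isTube_singleton u, rfl, rfl⟩

lemma isTube_componentOf {S : Set V} {u : V} (h : u ∈ S) : IsTube G (componentOf G S u) := by
  have e : componentOf G S u = ⋃₀ {D | D ⊆ S ∧ IsTube G D ∧ u ∈ D} := by
    ext v
    simp only [componentOf, Set.mem_ofPred_eq, Set.mem_sUnion, and_assoc]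
  rw [e]
  refine SimpleGraph.induce_sUnion_connected_of_pairwise_not_disjoint
    ⟨{u}, by simpa using h, isTube_singleton u, rfl⟩ ?_ ?_
  · exact fun hs ht => ⟨u, hs.2.2, ht.2.2⟩
  · exact fun hs => hs.2.1

lemma IsTube.subset_componentOf {S D : Set V} {u x : V} (hD : IsTube G D) (hS : D ⊆ S)
    (hx : x ∈ D) (hxu : x ∈ componentOf G S u) : D ⊆ componentOf G S u := by
  obtain ⟨E, hE, hEt, hu, hxE⟩ := hxu
  exact fun v hv => ⟨E ∪ D, Set.union_subset hE hS, hEt.union hD ⟨x, hxE, hx⟩, Or.inl hu, Or.inr hv⟩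

lemma mem_componentOf_of_adj {S : Set V} {u x y : V} (hx : x ∈ componentOf G S u) (hy : y ∈ S)
    (h : G.Adj x y) : y ∈ componentOf G S u :=
  (isTube_pair h).subset_componentOf
    (Set.insert_subset (componentOf_subset _ _ hx) (Set.singleton_subset_iff.2 hy))
    (Set.mem_insert _ _) hx (Set.mem_insert_of_mem _ rfl)

lemma isComponent_componentOf {S : Set V} {u : V} (h : u ∈ S) :
    IsComponent G S (componentOf G S u) :=
  ⟨⟨componentOf_subset _ _, isTube_componentOf h⟩, fun _ hD hle =>
    hD.2.subset_componentOf hD.1 (hle (mem_componentOf_self h)) (mem_componentOf_self h)⟩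

lemma IsComponent.eq_componentOf {S C : Set V} {u : V} (h : IsComponent G S C) (hu : u ∈ C) :
    C = componentOf G S u := by
  have hS := h.prop.1 hu
  have h1 : C ⊆ componentOf G S u :=
    h.prop.2.subset_componentOf h.prop.1 hu (mem_componentOf_self hS)
  exact Set.Subset.antisymm h1
    (h.le_of_ge ⟨componentOf_subset _ _, isTube_componentOf hS⟩ h1)

lemma IsComponent.eq_of_mem {S C D : Set V} {u : V} (h : IsComponent G S C)
    (h' : IsComponent G S D) (hu : u ∈ C) (hu' : u ∈ D) : C = D :=
  (h.eq_componentOf hu).trans (h'.eq_componentOf hu').symm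

/-! ### Nestings: the families of vertex sets of the subtrees of an elimination forest -/

/-- `T` assigns to every vertex the vertex set of its subtree in an elimination forest of `G`. -/
structure IsNesting (G : SimpleGraph V) (T : V → Set V) : Prop where
  refl : ∀ v, v ∈ T v
  trans : ∀ {u v}, u ∈ T v → T u ⊆ T v
  antisymm : ∀ {u v}, u ∈ T v → v ∈ T u → u = v
  tube : ∀ v, IsTube G (T v)
  comp : ∀ {u v}, G.Adj u v → u ∈ T v ∨ v ∈ T u
  laminar : ∀ {x a b}, x ∈ T a → x ∈ T b → a ∈ T b ∨ b ∈ T a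

/-- `o` is the parent of `v` in the forest with subtrees `T`. -/
def IsParent (T : V → Set V) (v : V) : Option V → Prop
  | none => ∀ x, v ∈ T x → x = v
  | some p => v ∈ T p ∧ p ≠ v ∧ ∀ x, v ∈ T x → x = v ∨ p ∈ T x

lemma IsNesting.isParent_unique {T : V → Set V} (hT : IsNesting G T) {v : V} {o o' : Option V}
    (h : IsParent T v o) (h' : IsParent T v o') : o = o' := by
  rcases o with _ | p <;> rcases o' with _ | q
  · rfl
  · exact absurd (h q h'.1) h'.2.1
  · exact absurd (h' p h.1) h.2.1
  · have h1 := (h.2.2 q h'.1).resolve_left h'.2.1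
    have h2 := (h'.2.2 p h.1).resolve_left h.2.1
    rw [hT.antisymm h1 h2]

/-- The sets containing `v` form a chain by laminarity, so the smallest one other than `T v` belongs
to the parent. -/
lemma IsNesting.exists_isParent [Finite V] {T : V → Set V} (hT : IsNesting G T) (v : V) :
    ∃ o, IsParent T v o := by
  by_cases hA : ∃ x, v ∈ T x ∧ x ≠ v
  · obtain ⟨p, ⟨hp, hpv⟩, hmin⟩ := Set.exists_min_image {x | v ∈ T x ∧ x ≠ v}
      (fun x => (T x).ncard) (Set.toFinite _) hA
    refine ⟨some p, hp, hpv, fun x hx => ?_⟩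
    by_cases hxv : x = v
    · exact Or.inl hxv
    right
    rcases hT.laminar hp hx with h | h
    · exact h
    · rw [Set.eq_of_subset_of_ncard_le (hT.trans h) (hmin x ⟨hx, hxv⟩)]
      exact hT.refl p
  · push Not at hA
    exact ⟨none, hA⟩

lemma IsNesting.ncard_lt [Finite V] {T : V → Set V} (hT : IsNesting G T) {u v : V}
    (h : u ∈ T v) (hne : u ≠ v) : (T u).ncard < (T v).ncard := by
  refine Set.ncard_lt_ncard ⟨hT.trans h, fun hle => hne ?_⟩
  exact hT.antisymm h (hle (hT.refl v))

/-- Every tube has a topmost vertex. -/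
lemma IsNesting.exists_top [Finite V] {T : V → Set V} (hT : IsNesting G T) {S : Set V}
    (hS : IsTube G S) : ∃ t ∈ S, S ⊆ T t := by
  -- A vertex of `S` with a largest subtree is the top: by connectedness, leaving `T t` inside `S`
  -- would need an edge to a vertex with a strictly larger subtree.
  obtain ⟨t, ht, hmax⟩ := Set.exists_max_image S (fun x => (T x).ncard) (Set.toFinite _)
    hS.nonempty
  refine ⟨t, ht, hS.subset_of_closed ht (hT.refl t) ?_⟩
  intro x y _ hy hadj hxt
  rcases hT.comp hadj with h | h
  · rcases hT.laminar h hxt with h' | h'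
    · exact h'
    · by_contra hcon
      have hne : t ≠ y := by
        rintro rfl
        exact hcon (hT.refl t)
      exact absurd (hT.ncard_lt h' hne) (not_lt.2 (hmax y hy))
  · exact hT.trans hxt h

lemma IsNesting.top_unique {T : V → Set V} (hT : IsNesting G T) {S : Set V} {s t : V}
    (hs : s ∈ S) (hs' : S ⊆ T s) (ht : t ∈ S) (ht' : S ⊆ T t) : s = t :=
  hT.antisymm (ht' hs) (hs' ht)

/-! ### Forests and their nestings -/

lemma mem_subtree_self (F : Forest V) (v : V) : v ∈ subtree F v := Relation.ReflTransGen.refl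

lemma subtree_trans {F : Forest V} {u v : V} (h : u ∈ subtree F v) : subtree F u ⊆ subtree F v :=
  fun _ hx => Relation.ReflTransGen.trans hx h

lemma mem_subtree_of_parent {F : Forest V} {u v : V} (h : F u = some v) : u ∈ subtree F v :=
  Relation.ReflTransGen.single h

lemma mem_subtree_iff {F : Forest V} {u v : V} :
    u ∈ subtree F v ↔ u = v ∨ ∃ p, F u = some p ∧ p ∈ subtree F v := by
  constructor
  · intro h
    rcases Relation.ReflTransGen.cases_head h with h | ⟨p, h, h'⟩
    · exact Or.inl h
    · exact Or.inr ⟨p, h, h'⟩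
  · rintro (rfl | ⟨p, h, h'⟩)
    · exact mem_subtree_self _ _
    · exact Relation.ReflTransGen.head h h'

lemma subtree_laminar {F : Forest V} {x a b : V} (ha : x ∈ subtree F a) (hb : x ∈ subtree F b) :
    a ∈ subtree F b ∨ b ∈ subtree F a :=
  Relation.ReflTransGen.total_of_right_unique
    (fun _ _ _ h h' => Option.some.inj (h.symm.trans h')) ha hb

/-- The forest `F` is an elimination forest of `G`, expressed through its subtrees. -/
structure IsNested (G : SimpleGraph V) (F : Forest V) : Prop where
  nesting : IsNesting G (subtree F)
  irrefl : ∀ v, F v ≠ some v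

lemma IsNested.isParent {F : Forest V} (hF : IsNested G F) (v : V) :
    IsParent (subtree F) v (F v) := by
  rcases hv : F v with _ | p
  · intro x hx
    rcases mem_subtree_iff.1 hx with h | ⟨p, h, _⟩
    · exact h.symm
    · simp [hv] at h
  · refine ⟨mem_subtree_of_parent hv, ?_, fun x hx => ?_⟩
    · rintro rfl
      exact hF.irrefl _ hv
    · rcases mem_subtree_iff.1 hx with h | ⟨q, h, h'⟩
      · exact Or.inl h.symm
      · rw [hv, Option.some.injEq] at h
        exact Or.inr (h ▸ h')

lemma IsNested.eq_of_isParent {F : Forest V} (hF : IsNested G F) {v : V} {o : Option V}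
    (h : IsParent (subtree F) v o) : F v = o :=
  hF.nesting.isParent_unique (hF.isParent v) h

lemma IsNested.ext {F F' : Forest V} (hF : IsNested G F) (hF' : IsNested G F')
    (h : subtree F = subtree F') : F = F' := by
  funext v
  exact hF.eq_of_isParent (h ▸ hF'.isParent v)

lemma IsNesting.subtree_eq [Finite V] {T : V → Set V} (hT : IsNesting G T) {F : Forest V}
    (hF : ∀ v, IsParent T v (F v)) : subtree F = T := by
  funext u
  ext v
  constructor
  · intro h
    induction h using Relation.ReflTransGen.head_induction_on with
    | refl => exact hT.refl _
    | @head a _ hac _ ih =>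
      have := hF a
      rw [hac] at this
      exact hT.trans ih this.1
  -- Induction on the number of vertices outside `T v`, which drops on passing to the parent.
  · induction hm : Nat.card V - (T v).ncard using Nat.strong_induction_on generalizing v with
    | _ m ih =>
      intro hv
      have hp := hF v
      rcases hFv : F v with _ | p
      · rw [hFv] at hp
        rw [hp u hv]
        exact mem_subtree_self _ _
      · rw [hFv] at hp
        rcases hp.2.2 u hv with rfl | hpu
        · exact mem_subtree_self _ _
        · refine mem_subtree_iff.2 (Or.inr ⟨p, hFv, ih _ ?_ p rfl hpu⟩)
          have h1 := hT.ncard_lt hp.1 hp.2.1.symm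
          have h2 := Set.ncard_le_card (T p)
          omega

lemma IsNesting.exists_isNested [Finite V] {T : V → Set V} (hT : IsNesting G T) :
    ∃ F, IsNested G F ∧ subtree F = T ∧ ∀ v, IsParent T v (F v) := by
  choose F hF using hT.exists_isParent
  have h := hT.subtree_eq hF
  refine ⟨F, ⟨h ▸ hT, fun v hv => ?_⟩, h, hF⟩
  have := hF v
  rw [hv] at this
  exact this.2.1 rfl

lemma IsNesting.isNested [Finite V] {T : V → Set V} (hT : IsNesting G T) {F : Forest V}
    (hF : ∀ v, IsParent T v (F v)) : IsNested G F ∧ subtree F = T := by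
  obtain ⟨F', h, h', h''⟩ := hT.exists_isNested
  have : F = F' := funext fun v => hT.isParent_unique (hF v) (h'' v)
  exact ⟨this ▸ h, this ▸ h'⟩

/-- An elimination forest is determined by a linear extension. -/
lemma IsNested.eq_of_monotone [Finite V] {α : Type*} [PartialOrder α] {f : V → α}
    (hf : Function.Injective f) {F F' : Forest V} (hF : IsNested G F) (hF' : IsNested G F')
    (h : ∀ u v, u ∈ subtree F v → f v ≤ f u) (h' : ∀ u v, u ∈ subtree F' v → f v ≤ f u) :
    F = F' := by
  have key : ∀ {F F' : Forest V}, IsNested G F → IsNested G F' →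
      (∀ u v, u ∈ subtree F v → f v ≤ f u) → (∀ u v, u ∈ subtree F' v → f v ≤ f u) →
      ∀ v, subtree F v ⊆ subtree F' v := by
    intro F F' hF hF' h h' v
    -- Both `v` and the top `t` in `F'` minimize `f` on `subtree F v`, so they coincide.
    obtain ⟨t, ht, hS⟩ := hF'.nesting.exists_top (hF.nesting.tube v)
    have e : v = t := hf (le_antisymm (h _ _ ht) (h' _ _ (hS (mem_subtree_self F v))))
    exact e ▸ hS
  exact hF.ext hF' (funext fun v =>
    Set.Subset.antisymm (key hF hF' h h' v) (key hF' hF h' h v))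

/-- Removing the vertices in the order given by `f`. -/
lemma isNesting_componentOf {α : Type*} [LinearOrder α] (G : SimpleGraph V) {f : V → α}
    (hf : Function.Injective f) : IsNesting G fun u => componentOf G {w | f u ≤ f w} u := by
  have self : ∀ u, u ∈ {w | f u ≤ f w} := fun u => le_refl _
  have le : ∀ {u v}, v ∈ componentOf G {w | f u ≤ f w} u → f u ≤ f v :=
    fun {u v} h => (componentOf_subset _ _ h : v ∈ {w | f u ≤ f w})
  have tr : ∀ {a b : V}, f b ≤ f a → ∀ {x}, x ∈ componentOf G {w | f a ≤ f w} a →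
      x ∈ componentOf G {w | f b ≤ f w} b →
      componentOf G {w | f a ≤ f w} a ⊆ componentOf G {w | f b ≤ f w} b := by
    intro a b hab x hxa hxb
    exact (isTube_componentOf (self a)).subset_componentOf
      (fun w hw => le_trans hab (le hw)) hxa hxb
  refine ⟨fun v => mem_componentOf_self (self v), ?_, ?_, fun v => isTube_componentOf (self v),
    ?_, ?_⟩
  · intro u v h
    exact tr (le h) (mem_componentOf_self (self u)) h
  · intro u v h h'
    exact hf (le_antisymm (le h') (le h))
  · intro u v h
    rcases le_total (f u) (f v) with h' | h'
    · exact Or.inr (mem_componentOf_of_adj (mem_componentOf_self (self u)) h' h)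
    · exact Or.inl (mem_componentOf_of_adj (mem_componentOf_self (self v)) h' h.symm)
  · intro x a b ha hb
    rcases le_total (f b) (f a) with h' | h'
    · exact Or.inl (tr h' ha hb (mem_componentOf_self (self a)))
    · exact Or.inr (tr h' hb ha (mem_componentOf_self (self b)))

/-! ### The inductive definition of elimination forests -/

lemma IsElimTree.root_mem {F : Forest V} {S : Set V} {x : V} (h : IsElimTree G F S x) :
    x ∈ S := by
  cases h; assumption

lemma IsElimTree.subset_subtree {F : Forest V} {S : Set V} {x : V} (h : IsElimTree G F S x) :
    S ⊆ subtree F x := by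
  induction h with
  | node S x r hS hx hpar hsub ih =>
    intro v hv
    by_cases hvx : v = x
    · exact hvx ▸ mem_subtree_self F v
    · have hC := isComponent_componentOf (G := G) (S := S \ {x}) ⟨hv, hvx⟩
      exact subtree_trans (mem_subtree_of_parent (hpar _ hC))
        (ih _ hC (mem_componentOf_self ⟨hv, hvx⟩))

/-- `IsElimTree` constrains `F` only at the roots of the components, so by itself it does not
prevent vertices outside `S` from hanging below `x`, nor a cycle through `x`. The hypotheses `hout`
and `hanc` exclude this, and both pass on to the subtrees of the children. -/
lemma IsElimTree.nested_of_isolated {F : Forest V} {S : Set V} {x : V}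
    (h : IsElimTree G F S x) (hanc : ∀ a ∈ S, x ∈ subtree F a → a = x) (hirr : F x ≠ some x)
    (hout : subtree F x ⊆ S) :
    ∀ v ∈ S, IsTube G (subtree F v) ∧ F v ≠ some v ∧
      (∀ p, F v = some p → p ∉ subtree F v) ∧
      ∀ u ∈ S, G.Adj u v → u ∈ subtree F v ∨ v ∈ subtree F u := by
  induction h with
  | node S x r hS hx hpar hsub ih =>
    have hall : S ⊆ subtree F x := (IsElimTree.node S x r hS hx hpar hsub).subset_subtree
    have hr : ∀ C, IsComponent G (S \ {x}) C → r C ∈ C := fun C hC => (hsub C hC).root_mem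
    have hrS : ∀ C, IsComponent G (S \ {x}) C → r C ∈ S := fun C hC => (hC.prop.1 (hr C hC)).1
    have hrx : ∀ C, IsComponent G (S \ {x}) C → r C ≠ x := fun C hC => (hC.prop.1 (hr C hC)).2
    have hr_anc : ∀ C, IsComponent G (S \ {x}) C → ∀ a ∈ S \ {x}, r C ∈ subtree F a →
        a = r C := by
      intro C hC a ha h
      rcases mem_subtree_iff.1 h with h | ⟨p, hp, hpa⟩
      · exact h.symm
      · rw [hpar C hC, Option.some.injEq] at hp
        exact absurd (hanc a ha.1 (hp ▸ hpa)) ha.2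
    have hchild : ∀ C (hC : IsComponent G (S \ {x}) C), subtree F (r C) ⊆ C := by
      intro C hC v hv
      have hvS : v ∈ S := hout (subtree_trans (mem_subtree_of_parent (hpar C hC)) hv)
      have hvx : v ≠ x := by
        rintro rfl
        exact hrx C hC (hanc _ (hrS C hC) hv)
      have hC' := isComponent_componentOf (G := G) (S := S \ {x}) ⟨hvS, hvx⟩
      have hvC' := mem_componentOf_self (G := G) (S := S \ {x}) ⟨hvS, hvx⟩
      set C' := componentOf G (S \ {x}) v
      have hv' : v ∈ subtree F (r C') := (hsub C' hC').subset_subtree hvC'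
      have e : r C = r C' := by
        rcases subtree_laminar hv hv' with h | h
        · exact (hr_anc C hC _ ⟨hrS C' hC', hrx C' hC'⟩ h).symm
        · exact hr_anc C' hC' _ ⟨hrS C hC, hrx C hC⟩ h
      have := hC.eq_of_mem hC' (hr C hC) (e ▸ hr C' hC')
      exact this ▸ hvC'
    have IH := fun C hC => ih C hC
      (fun a ha h => hr_anc C hC a (hC.prop.1 ha) h)
      (by rw [hpar C hC]; intro h; exact hrx C hC (Option.some.inj h).symm) (hchild C hC)
    have hsx : subtree F x = S := Set.Subset.antisymm hout hall
    intro v hv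
    by_cases hvx : v = x
    · subst hvx
      refine ⟨hsx.symm ▸ hS, hirr, fun p hp hp' => ?_, fun u hu _ => Or.inl (hall hu)⟩
      have := hanc p (hout hp') (mem_subtree_of_parent hp)
      exact hirr (this ▸ hp)
    · have hC := isComponent_componentOf (G := G) (S := S \ {x}) ⟨hv, hvx⟩
      have hvC := mem_componentOf_self (G := G) (S := S \ {x}) ⟨hv, hvx⟩
      obtain ⟨h1, h2, h3, h4⟩ := IH _ hC v hvC
      refine ⟨h1, h2, h3, fun u hu hadj => ?_⟩
      by_cases hux : u = x
      · exact Or.inr (hux ▸ hall hv)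
      · exact h4 u (mem_componentOf_of_adj hvC ⟨hu, hux⟩ hadj.symm) hadj

lemma IsElimForest.isNested {F : Forest V} (hF : IsElimForest G F) : IsNested G F := by
  have root_eq : ∀ {v x : V}, F x = none → x ∈ subtree F v → v = x := by
    intro v x hx h
    rcases mem_subtree_iff.1 h with h | ⟨p, hp, _⟩
    · exact h.symm
    · simp [hx] at hp
  have main : ∀ v, IsTube G (subtree F v) ∧ F v ≠ some v ∧
      (∀ p, F v = some p → p ∉ subtree F v) ∧
      ∀ u, G.Adj u v → u ∈ subtree F v ∨ v ∈ subtree F u := by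
    intro v
    have hC := isComponent_componentOf (G := G) (Set.mem_univ v)
    have hvC := mem_componentOf_self (G := G) (Set.mem_univ v)
    obtain ⟨x, hx, hT⟩ := hF _ hC
    have hout : subtree F x ⊆ componentOf G Set.univ v := by
      intro w hw
      have hC' := isComponent_componentOf (G := G) (Set.mem_univ w)
      have hwC := mem_componentOf_self (G := G) (Set.mem_univ w)
      obtain ⟨y, hy, hT'⟩ := hF _ hC'
      have e : x = y := by
        rcases subtree_laminar hw (hT'.subset_subtree hwC) with h | h
        · exact (root_eq hx h).symm
        · exact root_eq hy h
      rw [hC.eq_of_mem hC' hT.root_mem (e ▸ hT'.root_mem)]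
      exact hwC
    obtain ⟨h1, h2, h3, h4⟩ := hT.nested_of_isolated (fun a _ h => root_eq hx h)
      (by simp [hx]) hout v hvC
    exact ⟨h1, h2, h3, fun u h => h4 u (mem_componentOf_of_adj hvC (Set.mem_univ u) h.symm) h⟩
  refine ⟨⟨mem_subtree_self F, subtree_trans, ?_, fun v => (main v).1,
    fun h => (main _).2.2.2 _ h, subtree_laminar⟩, fun v => (main v).2.1⟩
  intro u v huv hvu
  rcases mem_subtree_iff.1 huv with h | ⟨p, hp, hpv⟩
  · exact h
  · exact absurd (subtree_trans hvu hpv) ((main u).2.2.1 p hp)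

lemma IsNested.isElimTree [Finite V] {F : Forest V} (hF : IsNested G F) (v : V) :
    IsElimTree G F (subtree F v) v := by
  have hT := hF.nesting
  induction hm : (subtree F v).ncard using Nat.strong_induction_on generalizing v with
  | _ m ih =>
    -- The components left after removing `v` are the subtrees of its children: the top `t` of a
    -- component has the whole component below it, and maximality forbids any tube between `t` and
    -- `v`.
    have key : ∀ C, IsComponent G (subtree F v \ {v}) C →
        ∃ t, F t = some v ∧ C = subtree F t := by
      intro C hC
      obtain ⟨t, ht, hCt⟩ := hT.exists_top hC.prop.2
      have htv := hC.prop.1 ht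
      have hmax : ∀ p, p ∈ subtree F v → p ≠ v → C ⊆ subtree F p → subtree F p ⊆ C := by
        intro p hp hpv hle
        refine hC.le_of_ge ⟨fun y hy => ⟨hT.trans hp hy, ?_⟩, hT.tube p⟩ hle
        rintro rfl
        exact hpv (hT.antisymm hp hy)
      refine ⟨t, ?_, Set.Subset.antisymm hCt (hmax t htv.1 htv.2 hCt)⟩
      have hp := hF.isParent t
      rcases hFt : F t with _ | p
      · rw [hFt] at hp
        exact absurd (hp v htv.1).symm htv.2
      · rw [hFt] at hp
        by_contra hne
        have hpv : p ≠ v := fun h => hne (h ▸ rfl)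
        have hpT := (hp.2.2 v htv.1).resolve_left (Ne.symm htv.2)
        have hle := hmax p hpT hpv (hCt.trans (hT.trans hp.1))
        exact hp.2.1 (hT.antisymm (hCt (hle (hT.refl p))) hp.1)
    have : Nonempty V := ⟨v⟩
    choose! r hr hr' using key
    refine IsElimTree.node _ v r (hT.tube v) (hT.refl v) hr fun C hC => ?_
    conv => arg 3; rw [hr' C hC]
    have hpar := hF.isParent (r C)
    rw [hr C hC] at hpar
    exact ih _ (hm ▸ hT.ncard_lt hpar.1 hpar.2.1.symm) _ rfl

lemma isElimForest_iff [Finite V] {F : Forest V} : IsElimForest G F ↔ IsNested G F := by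
  refine ⟨IsElimForest.isNested, fun hF C hC => ?_⟩
  have hT := hF.nesting
  obtain ⟨t, ht, hCt⟩ := hT.exists_top hC.prop.2
  have hmax : ∀ p, C ⊆ subtree F p → subtree F p ⊆ C := fun p hle =>
    hC.le_of_ge ⟨Set.subset_univ _, hT.tube p⟩ hle
  have hp := hF.isParent t
  refine ⟨t, ?_, ?_⟩
  · rcases hFt : F t with _ | p
    · rfl
    · rw [hFt] at hp
      have hle := hmax p (hCt.trans (hT.trans hp.1))
      exact absurd (hT.antisymm (hCt (hle (hT.refl p))) hp.1) hp.2.1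
  · rw [Set.Subset.antisymm hCt (hmax t hCt)]
    exact hF.isElimTree t

end Nesting

section Rotation

variable {V : Type*} {G : SimpleGraph V}

/-- The nesting `T'` arises from `T` by a rotation that moves `j` above its parent `i`. -/
structure IsSwap (T T' : V → Set V) (i j : V) : Prop where
  ne : i ≠ j
  eq : T' j = T i
  eq_of_ne : ∀ v, v ≠ i → v ≠ j → T' v = T v

lemma IsSwap.symm {T T' : V → Set V} {i j : V} (h : IsSwap T T' i j) : IsSwap T' T j i :=
  ⟨h.ne.symm, h.eq.symm, fun v hj hi => (h.eq_of_ne v hi hj).symm⟩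

lemma IsSwap.notMem {T T' : V → Set V} {i j : V} (hT : IsNesting G T) (hT' : IsNesting G T')
    (h : IsSwap T T' i j) : j ∉ T' i := fun hj =>
  h.ne (hT'.antisymm (by rw [h.eq]; exact hT.refl i) hj)

lemma IsSwap.mem {T T' : V → Set V} {i j : V} (hT' : IsNesting G T')
    (h : IsSwap T T' i j) : j ∈ T i := h.eq ▸ hT'.refl j

lemma IsSwap.isParent {T T' : V → Set V} {i j : V} (hT : IsNesting G T) (hT' : IsNesting G T')
    (h : IsSwap T T' i j) : IsParent T j (some i) := by
  refine ⟨h.mem hT', h.ne, fun x hx => ?_⟩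
  by_cases hxj : x = j
  · exact Or.inl hxj
  by_cases hxi : x = i
  · exact Or.inr (hxi ▸ hT.refl i)
  right
  rw [← h.eq_of_ne x hxi hxj] at hx ⊢
  exact hT'.trans hx (by rw [h.eq]; exact hT.refl i)

/-- The new subtree of `i` is connected, avoids `j`, and cannot be left along an edge of `T i \
{j}`: the other end would lie strictly above `i` in `T'` with an unchanged subtree, yet below `i` in
`T`. Hence a rotation is determined by `T`, `i` and `j`. -/
lemma IsSwap.eq_componentOf {T T' : V → Set V} {i j : V} (hT : IsNesting G T)
    (hT' : IsNesting G T') (h : IsSwap T T' i j) : T' i = componentOf G (T i \ {j}) i := by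
  have hij : i ∈ T' j := by rw [h.eq]; exact hT.refl i
  have hsub : T' i ⊆ T i \ {j} := by
    intro x hx
    refine ⟨h.eq ▸ hT'.trans hij hx, ?_⟩
    rintro rfl
    exact h.notMem hT hT' hx
  have hi : i ∈ T i \ {j} := ⟨hT.refl i, h.ne⟩
  refine Set.Subset.antisymm
    ((hT'.tube i).subset_componentOf hsub (hT'.refl i) (mem_componentOf_self hi)) ?_
  refine (isTube_componentOf hi).subset_of_closed (mem_componentOf_self hi) (hT'.refl i) ?_
  intro x y _ hy hadj hx
  have hy' := componentOf_subset _ _ hy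
  rcases hT'.comp hadj with hxy | hyx
  · rcases hT'.laminar hx hxy with hiy | hyi
    · have hyj : y ≠ j := hy'.2
      by_cases hyi : y = i
      · exact hyi ▸ hT'.refl i
      · rw [h.eq_of_ne y hyi hyj] at hiy
        exact absurd (hT.antisymm hy'.1 hiy) hyi
    · exact hyi
  · exact hT'.trans hx hyx

lemma IsSwap.eq_of_isSwap {T T' T'' : V → Set V} {i j : V} (hT : IsNesting G T)
    (hT' : IsNesting G T') (hT'' : IsNesting G T'') (h : IsSwap T T' i j)
    (h' : IsSwap T T'' i j) : T' = T'' := by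
  funext v
  by_cases hj : v = j
  · rw [hj, h.eq, h'.eq]
  by_cases hi : v = i
  · rw [hi, h.eq_componentOf hT hT', h'.eq_componentOf hT hT'']
  · rw [h.eq_of_ne v hi hj, h'.eq_of_ne v hi hj]

lemma IsSwap.left_ne {T T' : V → Set V} {i j : V} (hT : IsNesting G T) (hT' : IsNesting G T')
    (h : IsSwap T T' i j) : T' i ≠ T i :=
  fun e => h.notMem hT hT' (e ▸ h.mem hT')

lemma IsSwap.right_ne {T T' : V → Set V} {i j : V} (hT : IsNesting G T) (hT' : IsNesting G T')
    (h : IsSwap T T' i j) : T' j ≠ T j :=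
  fun e => h.symm.left_ne hT' hT e.symm

/-- Without an edge to `p`, the set `T v` would be closed under adjacency inside the connected set
`T p`, and so would contain `p`. -/
lemma IsNesting.exists_adj_of_isParent {T : V → Set V} (hT : IsNesting G T) {v p : V}
    (h : IsParent T v (some p)) : ∃ x ∈ T v, G.Adj x p := by
  by_contra! hcon
  refine h.2.1 (hT.antisymm ?_ h.1)
  refine (hT.tube p).subset_of_closed h.1 (hT.refl v) ?_ (hT.refl p)
  intro x y _ _ hadj hxv
  rcases hT.comp hadj with hxy | hyx
  · rcases hT.laminar hxv hxy with hvy | hyv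
    · rcases h.2.2 y hvy with rfl | hpy
      · exact hT.refl _
      · by_cases hyp : y = p
        · exact absurd (hyp ▸ hadj) (hcon x hxv)
        · exact absurd (hT.antisymm ‹y ∈ T p› hpy) hyp
    · exact hyv
  · exact hT.trans hxv hyx

section Exists

variable {T : V → Set V} {i j : V}

lemma IsNesting.parent_notMem (hT : IsNesting G T) (h : IsParent T j (some i)) : i ∉ T j :=
  fun hi => h.2.1 (hT.antisymm hi h.1)

/-- Below `i` but not below its child `j`. -/
lemma IsNesting.subset_diff (hT : IsNesting G T) (h : IsParent T j (some i)) {v : V}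
    (hv : v ∈ T i) (hvi : v ≠ i) (hvj : v ≠ j) : T v ⊆ T i \ {j} := by
  refine fun x hx => ⟨hT.trans hv hx, ?_⟩
  rintro rfl
  rcases h.2.2 v hx with h' | h'
  · exact hvj h'
  · exact hvi (hT.antisymm hv h')

open Classical in
/-- Every edge of a nesting can be rotated. -/
lemma IsNesting.exists_isSwap (hT : IsNesting G T) (h : IsParent T j (some i)) :
    ∃ T', IsNesting G T' ∧ IsSwap T T' i j := by
  set K := componentOf G (T i \ {j}) i with hK
  have hij : i ≠ j := h.2.1
  have hi : i ∈ T i \ {j} := ⟨hT.refl i, hij⟩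
  have hiK : i ∈ K := mem_componentOf_self hi
  have hKs : K ⊆ T i \ {j} := componentOf_subset _ _
  have hjK : j ∉ K := fun h => (hKs h).2 rfl
  -- A subtree strictly below `i` other than that of `j` avoids `j`, so it lies inside the component
  -- `K` as soon as it meets it.
  have hKt : ∀ {v x}, v ∈ T i → v ≠ i → v ≠ j → x ∈ T v → x ∈ K → T v ⊆ K := fun hv hvi hvj hx hxK =>
    (hT.tube _).subset_componentOf (hT.subset_diff h hv hvi hvj) hx hxK
  let T' : V → Set V := fun v => if v = j then T i else if v = i then K else T v
  have ej : T' j = T i := if_pos rfl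
  have ei : T' i = K := by simp [T', hij]
  have eo : ∀ v, v ≠ i → v ≠ j → T' v = T v := fun v h1 h2 => by simp [T', h1, h2]
  have split : ∀ v, v = i ∨ v = j ∨ (v ≠ i ∧ v ≠ j) := fun v => by tauto
  refine ⟨T', ⟨?_, ?_, ?_, ?_, ?_, ?_⟩, hij, ej, eo⟩
  · intro v
    rcases split v with rfl | rfl | ⟨h1, h2⟩
    · rwa [ei]
    · rw [ej]; exact h.1
    · rw [eo v h1 h2]; exact hT.refl v
  · intro u v huv
    rcases split v with rfl | rfl | ⟨h1, h2⟩
    · rw [ei] at huv ⊢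
      rcases split u with rfl | rfl | ⟨h3, h4⟩
      · rw [ei]
      · exact absurd huv hjK
      · rw [eo u h3 h4]
        exact hKt (hKs huv).1 h3 h4 (hT.refl u) huv
    · rw [ej] at huv ⊢
      rcases split u with rfl | rfl | ⟨h3, h4⟩
      · rw [ei]; exact fun x hx => (hKs hx).1
      · rw [ej]
      · rw [eo u h3 h4]; exact hT.trans huv
    · rw [eo v h1 h2] at huv ⊢
      rcases split u with rfl | rfl | ⟨h3, h4⟩
      · rw [ei]; exact fun x hx => hT.trans huv (hKs hx).1
      · rw [ej]; exact hT.trans ((h.2.2 v huv).resolve_left h2)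
      · rw [eo u h3 h4]; exact hT.trans huv
  · have aux : ∀ {u v}, v ≠ i → v ≠ j → u ∈ T' v → v ∈ T' u → u = v := by
      intro u v h1 h2 huv hvu
      rw [eo v h1 h2] at huv
      rcases split u with rfl | rfl | ⟨h3, h4⟩
      · rw [ei] at hvu
        exact hT.antisymm huv (hKs hvu).1
      · rw [ej] at hvu
        exact absurd (hT.antisymm hvu ((h.2.2 v huv).resolve_left h2)) h1
      · rw [eo u h3 h4] at hvu
        exact hT.antisymm huv hvu
    intro u v huv hvu
    rcases split v with rfl | rfl | ⟨h1, h2⟩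
    · rcases split u with rfl | rfl | ⟨h3, h4⟩
      · rfl
      · rw [ei] at huv
        exact absurd huv hjK
      · exact (aux h3 h4 hvu huv).symm
    · rcases split u with rfl | rfl | ⟨h3, h4⟩
      · rw [ei] at hvu
        exact absurd hvu hjK
      · rfl
      · exact (aux h3 h4 hvu huv).symm
    · exact aux h1 h2 huv hvu
  · intro v
    rcases split v with rfl | rfl | ⟨h1, h2⟩
    · rw [ei]; exact isTube_componentOf hi
    · rw [ej]; exact hT.tube i
    · rw [eo v h1 h2]; exact hT.tube v
  · have aux : ∀ {u v}, G.Adj u v → u ∈ T v → u ∈ T' v ∨ v ∈ T' u := by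
      intro u v hadj huv
      rcases split v with rfl | rfl | ⟨h1, h2⟩
      · by_cases hu : u = j
        · right; rw [hu, ej]; exact hT.refl v
        · left; rw [ei]; exact mem_componentOf_of_adj hiK ⟨huv, hu⟩ hadj.symm
      · left; rw [ej]; exact hT.trans h.1 huv
      · left; rw [eo v h1 h2]; exact huv
    intro u v hadj
    rcases hT.comp hadj with h' | h'
    · exact aux hadj h'
    · exact (aux hadj.symm h').symm
  · have auxj : ∀ {x b}, x ∈ T' j → x ∈ T' b → j ∈ T' b ∨ b ∈ T' j := by
      intro x b hx hb
      rw [ej] at hx ⊢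
      rcases split b with rfl | rfl | ⟨h1, h2⟩
      · exact Or.inr (hT.refl b)
      · exact Or.inr h.1
      · rw [eo b h1 h2] at hb ⊢
        rcases hT.laminar hx hb with h' | h'
        · exact Or.inl (hT.trans h' h.1)
        · exact Or.inr h'
    have auxi : ∀ {x b}, b ≠ i → b ≠ j → x ∈ T' i → x ∈ T' b → i ∈ T' b ∨ b ∈ T' i := by
      intro x b h1 h2 hx hb
      rw [ei] at hx ⊢
      rw [eo b h1 h2] at hb ⊢
      rcases hT.laminar (hKs hx).1 hb with h' | h'
      · exact Or.inl h'
      · exact Or.inr (hKt h' h1 h2 hb hx (hT.refl b))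
    intro x a b ha hb
    rcases split a with rfl | rfl | ⟨h1, h2⟩
    · rcases split b with rfl | rfl | ⟨h3, h4⟩
      · left; rwa [ei]
      · exact (auxj hb ha).symm
      · exact auxi h3 h4 ha hb
    · exact auxj ha hb
    · rcases split b with rfl | rfl | ⟨h3, h4⟩
      · exact (auxi h1 h2 hb ha).symm
      · exact (auxj hb ha).symm
      · rw [eo a h1 h2] at ha ⊢
        rw [eo b h3 h4] at hb ⊢
        exact hT.laminar ha hb

end Exists

/-- This ties the explicit parent function `rotate` to the abstract description by `IsSwap`: each
clause of `rotate` names the parent in the new nesting. -/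
lemma IsNested.isParent_rotate {F : Forest V} (hF : IsNested G F) {i j : V} (h : F j = some i)
    {T' : V → Set V} (hT' : IsNesting G T') (hs : IsSwap (subtree F) T' i j) (v : V) :
    IsParent T' v (rotate G F i j v) := by
  have hT := hF.nesting
  have hpj : IsParent (subtree F) j (some i) := h ▸ hF.isParent j
  have hK := hs.eq_componentOf hT hT'
  have hi : i ∈ subtree F i \ {j} := ⟨hT.refl i, hs.ne⟩
  have hKs : T' i ⊆ subtree F i \ {j} := hK ▸ componentOf_subset _ _
  have hKc : IsComponent G (subtree F i \ {j}) (T' i) := hK ▸ isComponent_componentOf hi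
  have hjK : j ∉ T' i := hs.notMem hT hT'
  have hij' : i ∈ T' j := by rw [hs.eq]; exact hT.refl i
  have split : ∀ v, v = i ∨ v = j ∨ (v ≠ i ∧ v ≠ j) := fun v => by tauto
  have hv := hF.isParent v
  unfold rotate
  split_ifs with h1 h2 h3
  · subst h1
    have hpi := hF.isParent i
    rcases hFi : F i with _ | p
    · rw [hFi] at hpi
      intro x hx
      rcases split x with rfl | rfl | ⟨h4, h5⟩
      · exact absurd hx hjK
      · rfl
      · rw [hs.eq_of_ne x h4 h5] at hx
        exact absurd (hpi x ((hpj.2.2 x hx).resolve_left h5)) h4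
    · rw [hFi] at hpi
      have hpv : p ≠ v := by
        rintro rfl
        exact hT.parent_notMem hpj hpi.1
      have hTp := hs.eq_of_ne p hpi.2.1 hpv
      refine ⟨by rw [hTp]; exact hT.trans hpi.1 hpj.1, hpv, fun x hx => ?_⟩
      rcases split x with rfl | rfl | ⟨h4, h5⟩
      · exact absurd hx hjK
      · exact Or.inl rfl
      · rw [hs.eq_of_ne x h4 h5] at hx ⊢
        exact Or.inr ((hpi.2.2 x ((hpj.2.2 x hx).resolve_left h5)).resolve_left h4)
  · subst h2
    refine ⟨hij', hs.ne.symm, fun x hx => ?_⟩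
    rcases split x with rfl | rfl | ⟨h4, h5⟩
    · exact Or.inl rfl
    · exact Or.inr (hT'.refl x)
    · rw [hs.eq_of_ne x h4 h5] at hx ⊢
      exact Or.inr (hT.trans hx hpj.1)
  · obtain ⟨hvj, C, hC, hiC, hvC⟩ := h3
    rw [hC.eq_of_mem hKc hiC (hT'.refl i)] at hvC
    rw [hvj] at hv
    refine ⟨hvC (hT.refl v), Ne.symm h2, fun x hx => ?_⟩
    rcases split x with rfl | rfl | ⟨h4, h5⟩
    · exact Or.inr (hT'.refl x)
    · exact Or.inr hij'
    · rw [hs.eq_of_ne x h4 h5] at hx ⊢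
      by_cases hxv : x = v
      · exact Or.inl hxv
      · exact Or.inr ((hpj.2.2 x ((hv.2.2 x hx).resolve_left hxv)).resolve_left h5)
  · have hTv := hs.eq_of_ne v h2 h1
    rcases hFv : F v with _ | p
    · rw [hFv] at hv
      intro x hx
      rcases split x with rfl | rfl | ⟨h4, h5⟩
      · exact absurd (hv x (hKs hx).1).symm h2
      · rw [hs.eq] at hx
        exact absurd (hv i hx).symm h2
      · rw [hs.eq_of_ne x h4 h5] at hx
        exact hv x hx
    · rw [hFv] at hv
      rcases split p with rfl | rfl | ⟨h4, h5⟩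
      -- Another child of the upper end of the edge: its subtree contains a neighbour of its parent,
      -- hence stays in the component of that parent.
      · obtain ⟨y, hy, hyp⟩ := hT.exists_adj_of_isParent hv
        have hsub := hT.subset_diff hpj hv.1 h2 h1
        have hyK : y ∈ T' p := by
          rw [hK]
          exact mem_componentOf_of_adj (mem_componentOf_self hi) (hsub hy) hyp.symm
        rw [hK] at hyK
        have hvK := (hT.tube v).subset_componentOf hsub hy hyK (hT.refl v)
        rw [← hK] at hvK
        refine ⟨hvK, hv.2.1, fun x hx => ?_⟩
        rcases split x with rfl | rfl | ⟨h6, h7⟩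
        · exact Or.inr (hT'.refl x)
        · exact Or.inr hij'
        · rw [hs.eq_of_ne x h6 h7] at hx ⊢
          exact hv.2.2 x hx
      · refine ⟨?_, hv.2.1, fun x hx => ?_⟩
        · rw [hs.eq]; exact hT.trans hpj.1 hv.1
        · rcases split x with rfl | rfl | ⟨h6, h7⟩
          -- A child of the lower end whose subtree joins the component of the upper end falls under
          -- the preceding clause of `rotate`.
          · exact absurd ⟨hFv, T' x, hKc, hT'.refl x, hTv ▸ hT'.trans hx⟩ h3
          · exact Or.inr (hT'.refl x)
          · rw [hs.eq_of_ne x h6 h7] at hx ⊢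
            exact hv.2.2 x hx
      · have hTp := hs.eq_of_ne p h4 h5
        refine ⟨by rw [hTp]; exact hv.1, hv.2.1, fun x hx => ?_⟩
        rcases split x with rfl | rfl | ⟨h6, h7⟩
        · right
          have hpi := (hv.2.2 x (hKs hx).1).resolve_left (Ne.symm h2)
          rw [hK] at hx ⊢
          exact (hT.tube p).subset_componentOf (hT.subset_diff hpj hpi h4 h5) hv.1 hx (hT.refl p)
        · right
          rw [hs.eq] at hx ⊢
          exact (hv.2.2 i hx).resolve_left (Ne.symm h2)
        · rw [hs.eq_of_ne x h6 h7] at hx ⊢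
          exact hv.2.2 x hx

/-- `F` and `F'` are elimination forests of `G` that differ by a rotation of the edge `{i, j}`. -/
structure Flips (G : SimpleGraph V) (F F' : Forest V) (i j : V) : Prop where
  left : IsNested G F
  right : IsNested G F'
  swap : IsSwap (subtree F) (subtree F') i j ∨ IsSwap (subtree F) (subtree F') j i

lemma Flips.symm {F F' : Forest V} {i j : V} (h : Flips G F F' i j) : Flips G F' F i j :=
  ⟨h.right, h.left, h.swap.symm.imp IsSwap.symm IsSwap.symm⟩

lemma Flips.ne {F F' : Forest V} {i j : V} (h : Flips G F F' i j) : i ≠ j :=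
  h.swap.elim (fun h => h.ne) fun h => h.ne.symm

lemma Flips.subtree_eq {F F' : Forest V} {i j : V} (h : Flips G F F' i j) {v : V} (hi : v ≠ i)
    (hj : v ≠ j) : subtree F' v = subtree F v :=
  h.swap.elim (fun h => h.eq_of_ne v hi hj) fun h => h.eq_of_ne v hj hi

lemma Flips.subtree_ne {F F' : Forest V} {i j : V} (h : Flips G F F' i j) :
    subtree F' i ≠ subtree F i :=
  h.swap.elim (fun hs => hs.left_ne h.left.nesting h.right.nesting)
    fun hs => hs.right_ne h.left.nesting h.right.nesting

/-- A rotation changes the subtrees of both ends of its edge and no others, so the resulting forest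
reveals the edge. This turns uniqueness of the next forest into uniqueness of the entry in `moves`.
-/
lemma Flips.eq_left {F F' : Forest V} {i i' j : V} (h : Flips G F F' i j)
    (h' : Flips G F F' i' j) : i = i' := by
  by_contra hne
  exact h.subtree_ne (h'.subtree_eq hne h.ne)

lemma IsNested.rotate [Finite V] {F : Forest V} (hF : IsNested G F) {i j : V}
    (h : F j = some i) : IsNested G (rotate G F i j) ∧
      IsSwap (subtree F) (subtree (rotate G F i j)) i j := by
  obtain ⟨T', hT', hs⟩ := hF.nesting.exists_isSwap (h ▸ hF.isParent j)
  obtain ⟨h1, h2⟩ := hT'.isNested (hF.isParent_rotate h hT' hs)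
  exact ⟨h1, h2 ▸ hs⟩

lemma IsSwap.eq_rotate [Finite V] {F F' : Forest V} (hF : IsNested G F) (hF' : IsNested G F')
    {i j : V} (h : IsSwap (subtree F) (subtree F') i j) :
    F j = some i ∧ F' = Elim.rotate G F i j := by
  have hp := hF.eq_of_isParent (h.isParent hF.nesting hF'.nesting)
  obtain ⟨h1, h2⟩ := hF.rotate hp
  exact ⟨hp, hF'.ext h1 (h.eq_of_isSwap hF.nesting hF'.nesting h1.nesting h2)⟩

lemma IsNested.flips_iff [Finite V] {F F' : Forest V} (hF : IsNested G F) {i j : V} :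
    Flips G F F' i j ↔ IsEdge F i j ∧ F' = rotateEdge G F i j := by
  have hnot : F i = some j → F j ≠ some i := fun h h' =>
    hF.nesting.parent_notMem (h' ▸ hF.isParent j) (mem_subtree_of_parent h)
  constructor
  · rintro ⟨-, hF', hs | hs⟩
    · obtain ⟨h, h'⟩ := hs.eq_rotate hF hF'
      exact ⟨Or.inl h, by rw [rotateEdge, if_pos h, h']⟩
    · obtain ⟨h, h'⟩ := hs.eq_rotate hF hF'
      exact ⟨Or.inr h, by rw [rotateEdge, if_neg (hnot h), h']⟩
  · rintro ⟨h | h, rfl⟩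
    · rw [rotateEdge, if_pos h]
      exact ⟨hF, (hF.rotate h).1, Or.inl (hF.rotate h).2⟩
    · rw [rotateEdge, if_neg (hnot h)]
      exact ⟨hF, (hF.rotate h).1, Or.inr (hF.rotate h).2⟩

lemma Flips.isRotation [Finite V] {F F' : Forest V} {i j : V} (h : Flips G F F' i j) :
    IsRotation G F F' := by
  rcases h.swap with hs | hs
  · exact ⟨i, j, hs.eq_rotate h.left h.right⟩
  · exact ⟨j, i, hs.eq_rotate h.left h.right⟩

end Rotation

/-! ### Vertices and edges of the graph associahedron. -/

section Polytope

open scoped Pointwise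

variable {n : ℕ} {G : SimpleGraph (Fin n)}

/-- The simplex spanned by the unit vectors `eᵢ` with `i ∈ S`. -/
def unitSimplex (S : Set (Fin n)) : Set (Fin n → ℝ) :=
  convexHull ℝ ((fun i : Fin n => (Pi.single i 1 : Fin n → ℝ)) '' S)

open Classical in
/-- The set of all tubes of `G`. -/
noncomputable def tubes (G : SimpleGraph (Fin n)) : Finset (Set (Fin n)) :=
  (Finset.univ : Finset (Set (Fin n))).filter (fun S => IsTube G S)

lemma mem_tubes {S : Set (Fin n)} : S ∈ tubes G ↔ IsTube G S := by
  simp [tubes]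

lemma mem_graphAssociahedron {x : Fin n → ℝ} :
    x ∈ graphAssociahedron G ↔
      ∃ y : Set (Fin n) → Fin n → ℝ, (∀ S ∈ tubes G, y S ∈ unitSimplex S) ∧
        ∑ S ∈ tubes G, y S = x := by
  rw [graphAssociahedron, Set.mem_finsetSum]
  simp only [exists_prop]
  rfl

lemma convex_graphAssociahedron : Convex ℝ (graphAssociahedron G) := by
  unfold graphAssociahedron
  refine Finset.sum_induction _ (fun s => Convex ℝ s) (fun _ _ => Convex.add) ?_
    fun S _ => convex_convexHull ℝ _
  exact convex_singleton 0

lemma single_mem_unitSimplex {S : Set (Fin n)} {i : Fin n} (h : i ∈ S) :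
    Pi.single i 1 ∈ unitSimplex S :=
  subset_convexHull ℝ _ ⟨i, h, rfl⟩

lemma unitSimplex_spec {S : Set (Fin n)} {y : Fin n → ℝ} (h : y ∈ unitSimplex S) :
    (∀ i, 0 ≤ y i) ∧ ∑ i, y i = 1 ∧ ∀ i, y i ≠ 0 → i ∈ S := by
  have hsub : unitSimplex S ⊆
      {y | (∀ i, 0 ≤ y i) ∧ ∑ i, y i = 1 ∧ ∀ i, i ∉ S → y i = 0} := by
    refine convexHull_min ?_ ?_
    · rintro _ ⟨i, hi, rfl⟩
      refine ⟨fun k => ?_, by simp, fun k hk => ?_⟩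
      · by_cases h : k = i
        · subst h; simp
        · simp [h]
      · have : k ≠ i := fun h => hk (h ▸ hi)
        simp [this]
    · rintro x ⟨hx1, hx2, hx3⟩ z ⟨hz1, hz2, hz3⟩ a b ha hb hab
      refine ⟨fun i => ?_, ?_, fun i hi => ?_⟩
      · have := hx1 i
        have := hz1 i
        simp only [Pi.add_apply, Pi.smul_apply, smul_eq_mul]
        positivity
      · simp only [Pi.add_apply, Pi.smul_apply, smul_eq_mul, Finset.sum_add_distrib,
          ← Finset.mul_sum, hx2, hz2, mul_one, hab]
      · simp [hx3 i hi, hz3 i hi]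
  obtain ⟨h1, h2, h3⟩ := hsub h
  exact ⟨h1, h2, fun i hi => by_contra fun hS => hi (h3 i hS)⟩

lemma eq_single_of_unitSimplex {S : Set (Fin n)} {y : Fin n → ℝ} (h : y ∈ unitSimplex S)
    {t : Fin n} (ht : ∀ i, y i ≠ 0 → i = t) : y = Pi.single t 1 := by
  obtain ⟨-, h2, -⟩ := unitSimplex_spec h
  have h0 : ∀ i, i ≠ t → y i = 0 := fun i hi => by_contra fun hy => hi (ht i hy)
  rw [Finset.sum_eq_single t (fun i _ hi => h0 i hi) (by simp)] at h2
  funext i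
  by_cases hi : i = t
  · subst hi; simp [h2]
  · simp [hi, h0 i hi]

/-- Maximizing a linear functional over a simplex. -/
lemma dotProduct_unitSimplex_le {S : Set (Fin n)} {y w : Fin n → ℝ} (h : y ∈ unitSimplex S)
    {t : Fin n} (ht : ∀ i ∈ S, w i ≤ w t) :
    w ⬝ᵥ y ≤ w t ∧ (w ⬝ᵥ y = w t → ∀ i, y i ≠ 0 → w i = w t) := by
  obtain ⟨h1, h2, h3⟩ := unitSimplex_spec h
  have hnn : ∀ i ∈ Finset.univ, 0 ≤ y i * (w t - w i) := by
    intro i _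
    by_cases hy : y i = 0
    · simp [hy]
    · exact mul_nonneg (h1 i) (sub_nonneg.2 (ht i (h3 i hy)))
  have hsum : ∑ i, y i * (w t - w i) = w t - w ⬝ᵥ y := by
    simp only [mul_sub, Finset.sum_sub_distrib, ← Finset.sum_mul, h2, one_mul, dotProduct]
    congr 1
    exact Finset.sum_congr rfl fun i _ => mul_comm _ _
  have := Finset.sum_nonneg hnn
  refine ⟨by linarith, fun he i hi => ?_⟩
  rw [he, sub_self, Finset.sum_eq_zero_iff_of_nonneg hnn] at hsum
  rcases mul_eq_zero.1 (hsum i (Finset.mem_univ i)) with h | h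
  · exact absurd h hi
  · linarith

open Classical in
/-- The unit vector of the topmost vertex of the tube `S` in `F`. -/
noncomputable def topVector (F : Forest (Fin n)) (S : Set (Fin n)) : Fin n → ℝ :=
  fun i => if i ∈ S ∧ S ⊆ subtree F i then 1 else 0

lemma topVector_eq_single {F : Forest (Fin n)} (hF : IsNested G F) {S : Set (Fin n)} {t : Fin n}
    (ht : t ∈ S) (hS : S ⊆ subtree F t) : topVector F S = Pi.single t 1 := by
  funext i
  by_cases h : i = t
  · subst h; simp [topVector, ht, hS]
  · have : ¬(i ∈ S ∧ S ⊆ subtree F i) := fun hi => h (hF.nesting.top_unique hi.1 hi.2 ht hS)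
    simp [topVector, this, h]

lemma sum_topVector (F : Forest (Fin n)) :
    ∑ S ∈ tubes G, topVector F S = assocVertex G F := by
  classical
  funext i
  rw [Finset.sum_apply]
  simp only [topVector, assocVertex]
  rw [Finset.sum_boole, Nat.cast_inj, ← Set.ncard_coe_finset]
  congr 1
  ext S
  simp [mem_tubes]

lemma topVector_mem {F : Forest (Fin n)} (hF : IsNested G F) {S : Set (Fin n)}
    (hS : S ∈ tubes G) : topVector F S ∈ unitSimplex S := by
  obtain ⟨t, ht, hSt⟩ := hF.nesting.exists_top (mem_tubes.1 hS)
  rw [topVector_eq_single hF ht hSt]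
  exact single_mem_unitSimplex ht

lemma assocVertex_mem {F : Forest (Fin n)} (hF : IsNested G F) :
    assocVertex G F ∈ graphAssociahedron G :=
  mem_graphAssociahedron.2 ⟨topVector F, fun _ => topVector_mem hF, sum_topVector F⟩

/-- The functional `w` does not increase when descending in `F`. -/
def IsCompatible (F : Forest (Fin n)) (w : Fin n → ℝ) : Prop :=
  ∀ u v, v ∈ subtree F u → w v ≤ w u

lemma IsCompatible.dotProduct_topVector {F : Forest (Fin n)} (hF : IsNested G F)
    {w : Fin n → ℝ} (hw : IsCompatible F w) {S : Set (Fin n)} (hS : S ∈ tubes G)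
    {y : Fin n → ℝ} (hy : y ∈ unitSimplex S) : w ⬝ᵥ y ≤ w ⬝ᵥ topVector F S := by
  obtain ⟨t, ht, hSt⟩ := hF.nesting.exists_top (mem_tubes.1 hS)
  rw [topVector_eq_single hF ht hSt, dotProduct_single, mul_one]
  exact (dotProduct_unitSimplex_le hy fun i hi => hw t i (hSt hi)).1

lemma IsCompatible.dotProduct_le {F : Forest (Fin n)} (hF : IsNested G F) {w : Fin n → ℝ}
    (hw : IsCompatible F w) {x : Fin n → ℝ} (hx : x ∈ graphAssociahedron G) :
    w ⬝ᵥ x ≤ w ⬝ᵥ assocVertex G F := by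
  obtain ⟨y, hy, rfl⟩ := mem_graphAssociahedron.1 hx
  rw [← sum_topVector, dotProduct_sum, dotProduct_sum]
  exact Finset.sum_le_sum fun S hS => hw.dotProduct_topVector hF hS (hy S hS)

/-- A sum attains the sum of the termwise bounds only if every term attains its own, so each `y S`
is supported where `w` equals its value at the top of `S`. -/
lemma IsCompatible.eq_of_dotProduct_le {F : Forest (Fin n)} (hF : IsNested G F) {w : Fin n → ℝ}
    (hw : IsCompatible F w) {y : Set (Fin n) → Fin n → ℝ}
    (hy : ∀ S ∈ tubes G, y S ∈ unitSimplex S)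
    (hle : w ⬝ᵥ assocVertex G F ≤ w ⬝ᵥ ∑ S ∈ tubes G, y S) {S : Set (Fin n)} (hS : S ∈ tubes G)
    {t : Fin n} (ht : t ∈ S) (hSt : S ⊆ subtree F t) {i : Fin n} (hi : y S i ≠ 0) :
    w i = w t := by
  have h1 : ∀ S ∈ tubes G, w ⬝ᵥ y S ≤ w ⬝ᵥ topVector F S := fun S hS =>
    hw.dotProduct_topVector hF hS (hy S hS)
  rw [← sum_topVector, dotProduct_sum, dotProduct_sum] at hle
  have h2 := (Finset.sum_eq_sum_iff_of_le h1).1 (le_antisymm (Finset.sum_le_sum h1) hle) S hS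
  rw [topVector_eq_single hF ht hSt, dotProduct_single, mul_one] at h2
  exact (dotProduct_unitSimplex_le (hy S hS) fun i hi => hw t i (hSt hi)).2 h2 i hi

/-- Subtree sizes drop strictly on descending, so this functional has a single maximizer on each
simplex. -/
lemma IsNested.topVector_unique {F : Forest (Fin n)} (hF : IsNested G F)
    {y : Set (Fin n) → Fin n → ℝ} (hy : ∀ S ∈ tubes G, y S ∈ unitSimplex S)
    (hle : (fun v => ((subtree F v).ncard : ℝ)) ⬝ᵥ assocVertex G F ≤
      (fun v => ((subtree F v).ncard : ℝ)) ⬝ᵥ ∑ S ∈ tubes G, y S)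
    {S : Set (Fin n)} (hS : S ∈ tubes G) : y S = topVector F S := by
  have hw : IsCompatible F fun v => ((subtree F v).ncard : ℝ) := fun u v h =>
    Nat.cast_le.2 (Set.ncard_le_ncard (hF.nesting.trans h))
  obtain ⟨t, ht, hSt⟩ := hF.nesting.exists_top (mem_tubes.1 hS)
  rw [topVector_eq_single hF ht hSt]
  refine eq_single_of_unitSimplex (hy S hS) fun i hi => ?_
  have h1 := hw.eq_of_dotProduct_le hF hy hle hS ht hSt hi
  by_contra hne
  have h2 := hF.nesting.ncard_lt (hSt ((unitSimplex_spec (hy S hS)).2.2 i hi)) hne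
  rw [Nat.cast_inj] at h1
  omega

lemma assocVertex_injOn {F F' : Forest (Fin n)} (hF : IsNested G F) (hF' : IsNested G F')
    (h : assocVertex G F = assocVertex G F') : F = F' := by
  have key : ∀ S ∈ tubes G, topVector F' S = topVector F S := fun S hS =>
    hF.topVector_unique (fun _ => topVector_mem hF') (by rw [sum_topVector, h]) hS
  have sub : ∀ {F F' : Forest (Fin n)}, IsNested G F →
      (∀ S ∈ tubes G, topVector F' S = topVector F S) → ∀ v, subtree F v ⊆ subtree F' v := by
    intro F F' hF key v
    -- The tube `subtree F v` has top `v` in `F`, hence also in `F'`, so it lies below `v` in `F'`.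
    have := congrFun (key _ (mem_tubes.2 (hF.nesting.tube v))) v
    by_contra hcon
    simp [topVector, hcon, mem_subtree_self] at this
  exact hF.ext hF' (funext fun v => Set.Subset.antisymm (sub hF key v)
    (sub hF' (fun S hS => (key S hS).symm) v))

/-- The linear functional with coefficients `w`. -/
noncomputable def functional (w : Fin n → ℝ) : StrongDual ℝ (Fin n → ℝ) :=
  ∑ i, w i • ContinuousLinearMap.proj i

lemma functional_apply (w x : Fin n → ℝ) : functional w x = w ⬝ᵥ x := by
  simp [functional, dotProduct]

lemma assocVertex_mem_extremePoints {F : Forest (Fin n)} (hF : IsNested G F) :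
    assocVertex G F ∈ (graphAssociahedron G).extremePoints ℝ := by
  apply exposedPoints_subset_extremePoints
  have hw : IsCompatible F fun v => ((subtree F v).ncard : ℝ) := fun u v h =>
    Nat.cast_le.2 (Set.ncard_le_ncard (hF.nesting.trans h))
  refine ⟨assocVertex_mem hF, functional fun v => ((subtree F v).ncard : ℝ), fun x hx => ?_⟩
  simp only [functional_apply]
  refine ⟨hw.dotProduct_le hF hx, fun hle => ?_⟩
  obtain ⟨y, hy, rfl⟩ := mem_graphAssociahedron.1 hx
  rw [← sum_topVector]
  exact Finset.sum_congr rfl fun S hS => hF.topVector_unique hy hle hS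

/-- Remove the vertices in order of decreasing weight; the second coordinate of the lexicographic
order only breaks ties. -/
lemma exists_isCompatible (G : SimpleGraph (Fin n)) (w : Fin n → ℝ) :
    ∃ F, IsNested G F ∧ IsCompatible F w := by
  let f : Fin n → ℝ ×ₗ Fin n := fun v => toLex (-w v, v)
  have hf : Function.Injective f := fun u v h => by
    have := toLex.injective h
    exact (Prod.mk.inj this).2
  obtain ⟨F, hF, hT, -⟩ := (isNesting_componentOf G hf).exists_isNested
  refine ⟨F, hF, fun u v h => ?_⟩
  rw [hT] at h
  have h' : f u ≤ f v := (componentOf_subset _ _ h : v ∈ {x | f u ≤ f x})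
  rcases (Prod.Lex.le_iff).1 h' with h1 | h1
  · simp only [f, ofLex_toLex] at h1
    linarith
  · simp only [f, ofLex_toLex] at h1
    linarith [h1.1]

/-- A point outside the hull would be separated from it by a functional, but that functional attains
its maximum over the polytope at the point of a compatible forest. -/
lemma graphAssociahedron_subset_convexHull :
    graphAssociahedron G ⊆ convexHull ℝ (assocVertex G '' {F | IsNested G F}) := by
  intro x hx
  by_contra hcon
  obtain ⟨f, u, hf, hu⟩ := geometric_hahn_banach_closed_point (convex_convexHull ℝ _)
    (((Set.toFinite {F | IsNested G F}).image (assocVertex G)).isClosed_convexHull ℝ) hcon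
  have hfw : ∀ z : Fin n → ℝ, f z = (fun i => f (Pi.single i 1)) ⬝ᵥ z := by
    intro z
    have := LinearMap.pi_apply_eq_sum_univ (f : (Fin n → ℝ) →ₗ[ℝ] ℝ) z
    simp only [dotProduct]
    refine Eq.trans this (Finset.sum_congr rfl fun i _ => ?_)
    rw [smul_eq_mul, mul_comm]
    have e : (fun k => if i = k then (1 : ℝ) else 0) = Pi.single i 1 := by
      funext k
      simp [Pi.single_apply, eq_comm]
    rw [e]
    rfl
  obtain ⟨F, hF, hw⟩ := exists_isCompatible G fun i => f (Pi.single i 1)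
  have h1 := hf _ (subset_convexHull ℝ _ ⟨F, hF, rfl⟩)
  have h2 := hw.dotProduct_le hF hx
  rw [← hfw, ← hfw] at h2
  linarith

lemma extremePoints_graphAssociahedron :
    (graphAssociahedron G).extremePoints ℝ = assocVertex G '' {F | IsNested G F} := by
  apply Set.Subset.antisymm
  · have e : graphAssociahedron G = convexHull ℝ (assocVertex G '' {F | IsNested G F}) := by
      refine Set.Subset.antisymm graphAssociahedron_subset_convexHull
        (convexHull_min ?_ convex_graphAssociahedron)
      rintro _ ⟨F, hF, rfl⟩
      exact assocVertex_mem hF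
    rw [e]
    exact extremePoints_convexHull_subset
  · rintro _ ⟨F, hF, rfl⟩
    exact assocVertex_mem_extremePoints hF

/-- Rotating the edge `{i, j}` moves the topmost vertex of a tube only from `i` to `j`. -/
lemma IsSwap.topVector_eq {F F' : Forest (Fin n)} (hF : IsNested G F) (hF' : IsNested G F')
    {i j : Fin n} (hs : IsSwap (subtree F) (subtree F') i j) {S : Set (Fin n)} (hS : IsTube G S)
    {t : Fin n} (ht : t ∈ S) (hSt : S ⊆ subtree F t) (h : ¬(t = i ∧ j ∈ S)) :
    topVector F' S = Pi.single t 1 := by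
  have hpj := hs.isParent hF.nesting hF'.nesting
  refine topVector_eq_single hF' ht ?_
  by_cases hj : t = j
  · subst hj
    rw [hs.eq]
    exact hSt.trans (hF.nesting.trans hpj.1)
  by_cases hi : t = i
  · subst hi
    have hjS : j ∉ S := fun hj => h ⟨rfl, hj⟩
    rw [hs.eq_componentOf hF.nesting hF'.nesting]
    refine hS.subset_componentOf (fun x hx => ⟨hSt hx, ?_⟩) ht
      (mem_componentOf_self ⟨mem_subtree_self F t, hj⟩)
    rintro rfl
    exact hjS hx
  · rwa [hs.eq_of_ne t hi hj]

/-- The weight is the subtree size in `F`, raised at `j` to tie with `i`; it is compatible with both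
forests. At a maximizer each tube contributes its top unit vector, except that a tube with top `i`
containing `j` may contribute any point of the segment from `e_i` to `e_j`. All deviations are thus
multiples of `e_j - e_i`, and `F'` realizes the largest one. -/
lemma IsSwap.isExposed {F F' : Forest (Fin n)} (hF : IsNested G F) (hF' : IsNested G F')
    {i j : Fin n} (hs : IsSwap (subtree F) (subtree F') i j) :
    IsExposed ℝ (graphAssociahedron G) (segment ℝ (assocVertex G F) (assocVertex G F')) := by
  have hT := hF.nesting
  have hpj := hs.isParent hF.nesting hF'.nesting
  have hij := hs.ne
  let w : Fin n → ℝ := fun v => if v = j then ((subtree F i).ncard : ℝ) else (subtree F v).ncard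
  have wj : w j = (subtree F i).ncard := if_pos rfl
  have wo : ∀ v, v ≠ j → w v = (subtree F v).ncard := fun v h => if_neg h
  have mono : ∀ {u v}, u ∈ subtree F v → ((subtree F u).ncard : ℝ) ≤ (subtree F v).ncard :=
    fun h => Nat.cast_le.2 (Set.ncard_le_ncard (hT.trans h))
  have strict : ∀ {u v}, u ∈ subtree F v → u ≠ v →
      ((subtree F u).ncard : ℝ) < (subtree F v).ncard := fun h h' =>
    Nat.cast_lt.2 (hT.ncard_lt h h')
  have hiT : ∀ {u}, u ≠ j → j ∈ subtree F u → i ∈ subtree F u := fun hu h =>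
    (hpj.2.2 _ h).resolve_left hu
  have hwle : ∀ v ∈ subtree F i, w v ≤ w j := by
    intro v hv
    by_cases hvj : v = j
    · rw [hvj]
    · rw [wj, wo v hvj]; exact mono hv
  have hw_of_ne : ∀ u v, u ≠ j → v ∈ subtree F u → w v ≤ w u := by
    intro u v hu h
    rw [wo u hu]
    by_cases hv : v = j
    · subst hv
      rw [wj]; exact mono (hiT hu h)
    · rw [wo v hv]; exact mono h
  have hw : IsCompatible F w := by
    intro u v h
    by_cases hu : u = j
    · subst hu; exact hwle v (hT.trans hpj.1 h)
    · exact hw_of_ne u v hu h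
  have hw' : IsCompatible F' w := by
    intro u v h
    by_cases hu : u = j
    · subst hu
      rw [hs.eq] at h
      exact hwle v h
    by_cases hui : u = i
    · subst hui
      rw [hs.eq_componentOf hT hF'.nesting] at h
      exact hw_of_ne u v hu (componentOf_subset _ _ h).1
    · rw [hs.eq_of_ne u hui hu] at h
      exact hw_of_ne u v hu h
  have heq : w ⬝ᵥ assocVertex G F' = w ⬝ᵥ assocVertex G F :=
    le_antisymm (hw.dotProduct_le hF (assocVertex_mem hF'))
      (hw'.dotProduct_le hF' (assocVertex_mem hF))
  intro _
  refine ⟨functional w, ?_⟩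
  simp only [functional_apply]
  ext x
  constructor
  · intro hx
    refine ⟨convex_graphAssociahedron.segment_subset (assocVertex_mem hF)
      (assocVertex_mem hF') hx, fun z hz => ?_⟩
    obtain ⟨a, b, ha, hb, hab, rfl⟩ := hx
    have hz' := hw.dotProduct_le hF hz
    rw [dotProduct_add, dotProduct_smul, dotProduct_smul, heq, ← add_smul, hab, one_smul]
    exact hz'
  · rintro ⟨hx, hmax⟩
    have hle := hmax _ (assocVertex_mem hF)
    obtain ⟨y, hy, rfl⟩ := mem_graphAssociahedron.1 hx
    set d : Fin n → ℝ := Pi.single j 1 - Pi.single i 1 with hd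
    have key : ∀ S ∈ tubes G, ∃ c m : ℝ, 0 ≤ c ∧ c ≤ m ∧ y S = topVector F S + c • d ∧
        topVector F' S = topVector F S + m • d := by
      intro S hS
      obtain ⟨t, ht, hSt⟩ := hT.exists_top (mem_tubes.1 hS)
      obtain ⟨y0, y1, yS⟩ := unitSimplex_spec (hy S hS)
      have hwt : ∀ k, y S k ≠ 0 → w k = w t := fun k hk =>
        hw.eq_of_dotProduct_le hF hy hle hS ht hSt hk
      have hFS := topVector_eq_single hF ht hSt
      by_cases h : t = i ∧ j ∈ S
      · obtain ⟨rfl, hjS⟩ := h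
        have hF'S : topVector F' S = Pi.single j 1 :=
          topVector_eq_single hF' hjS (by rw [hs.eq]; exact hSt)
        have hy0 : ∀ k, k ≠ t → k ≠ j → y S k = 0 := by
          intro k hkt hkj
          by_contra hk
          have h1 := hwt k hk
          rw [wo k hkj, wo t hij] at h1
          exact (strict (hSt (yS k hk)) hkt).ne h1
        have hsum : y S t + y S j = 1 := by
          rw [← y1, ← Finset.sum_pair (f := y S) hij]
          refine Finset.sum_subset (Finset.subset_univ _) fun k _ hk => ?_
          simp only [Finset.mem_insert, Finset.mem_singleton, not_or] at hk
          exact hy0 k hk.1 hk.2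
        refine ⟨y S j, 1, y0 j, by linarith [y0 t], ?_, ?_⟩
        · rw [hFS]
          funext k
          by_cases hkt : k = t
          · subst hkt
            simp [hd, hij]
            linarith
          · by_cases hkj : k = j
            · subst hkj
              simp [hd, hij.symm]
            · simp [hd, hkt, hkj, hy0 k hkt hkj]
        · rw [hFS, hF'S, hd]
          simp
      · refine ⟨0, 0, le_rfl, le_rfl, ?_, ?_⟩
        · rw [zero_smul, add_zero, hFS]
          refine eq_single_of_unitSimplex (hy S hS) fun k hk => ?_
          by_contra hne
          have hkt := hSt (yS k hk)
          have h1 := hwt k hk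
          by_cases hkj : k = j
          · subst hkj
            have hit := hiT (Ne.symm hne) hkt
            rw [wj, wo t (Ne.symm hne)] at h1
            refine h ⟨?_, yS k hk⟩
            by_contra hti
            exact (strict hit (Ne.symm hti)).ne h1
          · rw [wo k hkj] at h1
            by_cases htj : t = j
            · subst htj
              rw [wj] at h1
              exact ((strict hkt hne).trans_le (mono hpj.1)).ne h1
            · rw [wo t htj] at h1
              exact (strict hkt hne).ne h1
        · rw [zero_smul, add_zero, hFS]
          exact hs.topVector_eq hF hF' (mem_tubes.1 hS) ht hSt h
    choose! c m hc hcm hyc htm using key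
    have hx' : ∑ S ∈ tubes G, y S = assocVertex G F + (∑ S ∈ tubes G, c S) • d := by
      rw [← sum_topVector, Finset.sum_smul, ← Finset.sum_add_distrib]
      exact Finset.sum_congr rfl hyc
    have hv' : assocVertex G F' = assocVertex G F + (∑ S ∈ tubes G, m S) • d := by
      rw [← sum_topVector, ← sum_topVector, Finset.sum_smul, ← Finset.sum_add_distrib]
      exact Finset.sum_congr rfl htm
    have hC : 0 ≤ ∑ S ∈ tubes G, c S := Finset.sum_nonneg hc
    have hCM : ∑ S ∈ tubes G, c S ≤ ∑ S ∈ tubes G, m S := Finset.sum_le_sum hcm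
    set C := ∑ S ∈ tubes G, c S
    set M := ∑ S ∈ tubes G, m S
    rw [segment_eq_image']
    -- For `M = 0` the quotient is `0` by convention, which is still right because then `C = 0`.
    refine ⟨C / M, ⟨div_nonneg hC (hC.trans hCM), div_le_one_of_le₀ hCM (hC.trans hCM)⟩, ?_⟩
    simp only
    rw [hx', hv', add_sub_cancel_left, smul_smul, div_mul_cancel_of_imp]
    intro hM
    exact le_antisymm (hM ▸ hCM) hC

lemma Flips.isExposed {F F' : Forest (Fin n)} {i j : Fin n} (h : Flips G F F' i j) :
    IsExposed ℝ (graphAssociahedron G) (segment ℝ (assocVertex G F) (assocVertex G F')) := by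
  rcases h.swap with hs | hs
  · exact hs.isExposed h.left h.right
  · exact hs.isExposed h.left h.right

/-- A sequence of all elimination forests in which consecutive forests differ by a rotation gives a
Hamilton path on the graph associahedron. -/
lemma exists_isHamiltonian [DecidableEq ((graphAssociahedron G).extremePoints ℝ)]
    {L : List (Forest (Fin n))} (hne : L ≠ []) (hnd : L.Nodup)
    (hL : ∀ F, F ∈ L ↔ IsNested G F) (hc : L.IsChain fun F F' => ∃ i j, Flips G F F' i j) :
    ∃ (a b : (graphAssociahedron G).extremePoints ℝ)
      (p : (skeleton (graphAssociahedron G)).Walk a b),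
      p.IsHamiltonian ∧ p.support.map Subtype.val = L.map (assocVertex G) := by
  classical
  obtain ⟨F₀, hF₀⟩ := List.exists_mem_of_ne_nil L hne
  -- The second branch is a filler value; `L` contains only elimination forests.
  let g : Forest (Fin n) → (graphAssociahedron G).extremePoints ℝ := fun F =>
    if h : IsNested G F then ⟨assocVertex G F, assocVertex_mem_extremePoints h⟩
    else ⟨assocVertex G F₀, assocVertex_mem_extremePoints ((hL F₀).1 hF₀)⟩
  have hg : ∀ {F}, IsNested G F → (g F : Fin n → ℝ) = assocVertex G F := fun h => by
    simp only [g, dif_pos h]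
  have hne' : L.map g ≠ [] := by simpa using hne
  have hchain : (L.map g).IsChain (skeleton (graphAssociahedron G)).Adj := by
    rw [List.isChain_map]
    refine hc.imp fun F F' => ?_
    rintro ⟨i, j, h⟩
    refine ⟨fun e => ?_, ?_⟩
    · have e' := congrArg Subtype.val e
      rw [hg h.left, hg h.right] at e'
      refine h.subtree_ne ?_
      rw [assocVertex_injOn h.left h.right e']
    · rw [hg h.left, hg h.right]
      exact h.isExposed
  have hsupp := SimpleGraph.Walk.support_ofSupport hne' hchain
  refine ⟨_, _, SimpleGraph.Walk.ofSupport _ hne' hchain, ?_, ?_⟩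
  · refine SimpleGraph.Walk.IsPath.isHamiltonian_of_mem (SimpleGraph.Walk.IsPath.mk' ?_)
      fun a => ?_
    · rw [hsupp]
      refine (List.nodup_map_iff_inj_on hnd).2 fun F hF F' hF' e => ?_
      have e' := congrArg Subtype.val e
      rw [hg ((hL F).1 hF), hg ((hL F').1 hF')] at e'
      exact assocVertex_injOn ((hL F).1 hF) ((hL F').1 hF') e'
    · rw [hsupp]
      obtain ⟨F, hF, hFa⟩ := extremePoints_graphAssociahedron.subset a.2
      exact List.mem_map.2 ⟨F, (hL F).2 hF, Subtype.ext ((hg hF).trans hFa)⟩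
  · rw [hsupp, List.map_map]
    exact List.map_congr_left fun F hF => hg ((hL F).1 hF)

end Polytope

/-! ### Deleting and inserting the last vertex. -/

section LastVertex

variable {V : Type*} in
lemma isTube_of_closed {G : SimpleGraph V} {S : Set V} {a : V} (ha : a ∈ S)
    (h : ∀ A : Set V, a ∈ A → (∀ x y, x ∈ S → y ∈ S → G.Adj x y → x ∈ A → y ∈ A) → S ⊆ A) :
    IsTube G S := by
  have := h (componentOf G S a) (mem_componentOf_self ha)
    fun x y _ hy hadj hx => mem_componentOf_of_adj hx hy hadj
  rw [Set.Subset.antisymm this (componentOf_subset _ _)]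
  exact isTube_componentOf ha

variable {V : Type*} in
/-- A tube with at least two vertices contains a neighbour of each of its vertices. -/
lemma IsTube.exists_adj {G : SimpleGraph V} {S : Set V} (hS : IsTube G S) {a b : V} (ha : a ∈ S)
    (hb : b ∈ S) (hne : b ≠ a) : ∃ x ∈ S, G.Adj a x := by
  by_contra! hcon
  refine hne (hS.subset_of_closed ha (Set.mem_singleton a) ?_ hb)
  rintro x y _ hy hadj rfl
  exact absurd hadj (hcon y hy)

variable {n : ℕ} {G : SimpleGraph (Fin (n + 1))}

lemma IsPEO.comap (hG : IsPEO G) : IsPEO (G.comap Fin.castSucc) := by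
  intro x a ha b hb hab
  have h := hG x.castSucc
  refine @h a.castSucc ?_ b.castSucc ?_ fun h => hab (Fin.castSucc_injective n h)
  · exact ha.imp (fun h => congrArg _ h) fun h => ⟨Fin.castSucc_lt_castSucc_iff.2 h.1, h.2⟩
  · exact hb.imp (fun h => congrArg _ h) fun h => ⟨Fin.castSucc_lt_castSucc_iff.2 h.1, h.2⟩

lemma IsPEO.adj_of_adj_last (hG : IsPEO G) {x y : Fin n}
    (hx : G.Adj (Fin.last n) x.castSucc) (hy : G.Adj (Fin.last n) y.castSucc) (hne : x ≠ y) :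
    G.Adj x.castSucc y.castSucc :=
  hG (Fin.last n) (Or.inr ⟨Fin.castSucc_lt_last x, hx⟩) (Or.inr ⟨Fin.castSucc_lt_last y, hy⟩)
    fun h => hne (Fin.castSucc_injective n h)

lemma IsTube.image_castSucc {D : Set (Fin n)} (hD : IsTube (G.comap Fin.castSucc) D) :
    IsTube G (Fin.castSucc '' D) := by
  obtain ⟨d, hd⟩ := hD.nonempty
  refine isTube_of_closed (Set.mem_image_of_mem _ hd) fun A hdA hA => ?_
  rw [Set.image_subset_iff]
  exact hD.subset_of_closed hd hdA fun x y hx hy hadj hxA =>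
    hA _ _ (Set.mem_image_of_mem _ hx) (Set.mem_image_of_mem _ hy) hadj hxA

/-- The last vertex is simplicial: a path through it can be shortcut along the edge between its two
neighbours. -/
lemma IsTube.preimage_castSucc (hG : IsPEO G) {S : Set (Fin (n + 1))} (hS : IsTube G S)
    {a : Fin n} (ha : a.castSucc ∈ S) : IsTube (G.comap Fin.castSucc) (Fin.castSucc ⁻¹' S) := by
  refine isTube_of_closed (a := a) ha fun A haA hA => ?_
  -- `A` within `S`, together with the last vertex if that has a neighbour there. The clique
  -- condition makes `B` closed under adjacency in `S`.
  let B : Set (Fin (n + 1)) := {x | (∃ y ∈ A, y.castSucc ∈ S ∧ x = y.castSucc) ∨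
    (x = Fin.last n ∧ ∃ y ∈ A, y.castSucc ∈ S ∧ G.Adj (Fin.last n) y.castSucc)}
  have hB : S ⊆ B := by
    refine hS.subset_of_closed ha (Or.inl ⟨a, haA, ha, rfl⟩) ?_
    rintro x y hx hy hadj (⟨x', hx'A, hx'S, rfl⟩ | ⟨rfl, k, hkA, hkS, hk⟩)
    · induction y using Fin.lastCases with
      | last => exact Or.inr ⟨rfl, x', hx'A, hx'S, hadj.symm⟩
      | cast y => exact Or.inl ⟨y, hA x' y hx'S hy hadj hx'A, hy, rfl⟩
    · induction y using Fin.lastCases with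
      | last => exact absurd hadj (G.loopless.irrefl _)
      | cast y =>
        refine Or.inl ⟨y, ?_, hy, rfl⟩
        by_cases hky : k = y
        · exact hky ▸ hkA
        · exact hA k y hkS hy (hG.adj_of_adj_last hk hadj hky) hkA
  intro v hv
  rcases hB hv with ⟨y, hy, -, e⟩ | ⟨e, -⟩
  · rwa [Fin.castSucc_injective n e]
  · exact absurd e (Fin.castSucc_lt_last v).ne

lemma IsNesting.preimage_castSucc (hG : IsPEO G) {T : Fin (n + 1) → Set (Fin (n + 1))}
    (hT : IsNesting G T) :
    IsNesting (G.comap Fin.castSucc) fun v => Fin.castSucc ⁻¹' T v.castSucc where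
  refl _ := hT.refl _
  trans h _ hx := hT.trans h hx
  antisymm h h' := Fin.castSucc_injective n (hT.antisymm h h')
  tube v := (hT.tube v.castSucc).preimage_castSucc hG (hT.refl _)
  comp h := hT.comp h
  laminar h h' := hT.laminar h h'

/-- Deleting the last vertex from the forest `F` yields the forest `F'`. -/
def Restricts (F : Forest (Fin (n + 1))) (F' : Forest (Fin n)) : Prop :=
  ∀ v, subtree F' v = Fin.castSucc ⁻¹' subtree F v.castSucc

lemma Restricts.mem_iff {F : Forest (Fin (n + 1))} {F' : Forest (Fin n)} (h : Restricts F F')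
    {u v : Fin n} : u.castSucc ∈ subtree F v.castSucc ↔ u ∈ subtree F' v := by
  rw [h v]; rfl

lemma IsNested.exists_restricts (hG : IsPEO G) {F : Forest (Fin (n + 1))} (hF : IsNested G F) :
    ∃ F', IsNested (G.comap Fin.castSucc) F' ∧ Restricts F F' := by
  obtain ⟨F', h, h', -⟩ := (hF.nesting.preimage_castSucc hG).exists_isNested
  exact ⟨F', h, fun v => congrFun h' v⟩

lemma Restricts.unique {F : Forest (Fin (n + 1))} {F' F'' : Forest (Fin n)}
    (hF' : IsNested (G.comap Fin.castSucc) F') (hF'' : IsNested (G.comap Fin.castSucc) F'')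
    (h' : Restricts F F') (h'' : Restricts F F'') : F' = F'' :=
  hF'.ext hF'' (funext fun v => (h' v).trans (h'' v).symm)

/-- The vertices above the last vertex. -/
def upperSet (F : Forest (Fin (n + 1))) : Set (Fin n) :=
  {v | Fin.last n ∈ subtree F v.castSucc}

/-- The vertices whose subtree contains a neighbour of the last vertex. -/
def attachSet (G : SimpleGraph (Fin (n + 1))) (F' : Forest (Fin n)) : Set (Fin n) :=
  {v | ∃ k ∈ subtree F' v, G.Adj (Fin.last n) k.castSucc}

/-- The last vertex can be attached as a leaf to every elimination forest. -/
lemma exists_restricts_leaf (hG : IsPEO G) {F' : Forest (Fin n)}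
    (hF' : IsNested (G.comap Fin.castSucc) F') :
    ∃ F, IsNested G F ∧ Restricts F F' ∧ subtree F (Fin.last n) = {Fin.last n} := by
  have hT' := hF'.nesting
  let T : Fin (n + 1) → Set (Fin (n + 1)) := fun x => Fin.lastCases {Fin.last n}
    (fun v => Fin.castSucc '' subtree F' v ∪ {z | z = Fin.last n ∧ v ∈ attachSet G F'}) x
  have Tl : T (Fin.last n) = {Fin.last n} := by simp [T]
  have Tc : ∀ u v : Fin n, u.castSucc ∈ T v.castSucc ↔ u ∈ subtree F' v := by
    intro u v
    simp [T, (Fin.castSucc_lt_last u).ne]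
  have Tz : ∀ v : Fin n, Fin.last n ∈ T v.castSucc ↔ v ∈ attachSet G F' := by
    intro v
    simp [T, fun u : Fin n => (Fin.castSucc_lt_last u).ne]
  have Tcl : ∀ u : Fin n, u.castSucc ∉ T (Fin.last n) := fun u h => by
    rw [Tl] at h
    exact (Fin.castSucc_lt_last u).ne h
  have hTl : Fin.last n ∈ T (Fin.last n) := by rw [Tl]; rfl
  have Tn : IsNesting G T := by
    refine ⟨?_, ?_, ?_, ?_, ?_, ?_⟩
    · intro v
      induction v using Fin.lastCases with
      | last => exact hTl
      | cast v => rw [Tc]; exact hT'.refl v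
    · intro u v h x hx
      induction v using Fin.lastCases with
      | last =>
        rw [Tl, Set.mem_singleton_iff] at h
        rwa [h] at hx
      | cast v =>
        induction u using Fin.lastCases with
        | last =>
          rw [Tl, Set.mem_singleton_iff] at hx
          rwa [hx]
        | cast u =>
          rw [Tc] at h
          induction x using Fin.lastCases with
          | last =>
            rw [Tz] at hx ⊢
            obtain ⟨k, hk, hadj⟩ := hx
            exact ⟨k, hT'.trans h hk, hadj⟩
          | cast x =>
            rw [Tc] at hx ⊢
            exact hT'.trans h hx
    · intro u v h h'
      induction v using Fin.lastCases with
      | last =>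
        rw [Tl] at h
        exact h
      | cast v =>
        induction u using Fin.lastCases with
        | last => exact absurd h' (Tcl v)
        | cast u =>
          rw [Tc] at h h'
          rw [hT'.antisymm h h']
    · intro v
      induction v using Fin.lastCases with
      | last => rw [Tl]; exact isTube_singleton _
      | cast v =>
        have h1 : IsTube G (Fin.castSucc '' subtree F' v) := (hT'.tube v).image_castSucc
        by_cases hv : v ∈ attachSet G F'
        · obtain ⟨k, hk, hadj⟩ := hv
          have h2 := h1.union (isTube_pair hadj) ⟨_, Set.mem_image_of_mem _ hk, by simp⟩
          convert h2 using 1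
          ext x
          induction x using Fin.lastCases with
          | last => simpa [Tz] using ⟨k, hk, hadj⟩
          | cast x =>
            rw [Tc]
            simp only [Set.mem_union, Set.mem_insert_iff, Set.mem_singleton_iff,
              (Fin.castSucc_lt_last x).ne, false_or, Fin.castSucc_inj,
              (Fin.castSucc_injective n).mem_set_image]
            exact ⟨Or.inl, fun h => h.elim id fun h => h ▸ hk⟩
        · convert h1 using 1
          ext x
          induction x using Fin.lastCases with
          | last => simp [Tz, hv, fun u : Fin n => (Fin.castSucc_lt_last u).ne]
          | cast x => rw [Tc, (Fin.castSucc_injective n).mem_set_image]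
    · intro u v hadj
      induction v using Fin.lastCases with
      | last =>
        induction u using Fin.lastCases with
        | last => exact absurd hadj (G.loopless.irrefl _)
        | cast u => exact Or.inr ((Tz u).2 ⟨u, hT'.refl u, hadj.symm⟩)
      | cast v =>
        induction u using Fin.lastCases with
        | last => exact Or.inl ((Tz v).2 ⟨v, hT'.refl v, hadj⟩)
        | cast u => simpa only [Tc] using hT'.comp hadj
    · intro x a b ha hb
      induction a using Fin.lastCases with
      | last =>
        rw [Tl, Set.mem_singleton_iff] at ha
        exact Or.inl (ha ▸ hb)
      | cast a =>
        induction b using Fin.lastCases with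
        | last =>
          rw [Tl, Set.mem_singleton_iff] at hb
          exact Or.inr (hb ▸ ha)
        | cast b =>
          rw [Tc, Tc]
          induction x using Fin.lastCases with
          | cast x =>
            rw [Tc] at ha hb
            exact hT'.laminar ha hb
          | last =>
            rw [Tz] at ha hb
            obtain ⟨k, hk, hkz⟩ := ha
            obtain ⟨l, hl, hlz⟩ := hb
            -- Two subtrees that contain the last vertex contain neighbours `k` and `l` of it; these
            -- are equal or adjacent, hence comparable in `F'`.
            by_cases hkl : k = l
            · exact hT'.laminar hk (hkl ▸ hl)
            · rcases hT'.comp (G := G.comap Fin.castSucc)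
                (hG.adj_of_adj_last hkz hlz hkl) with h | h
              · exact hT'.laminar hk (hT'.trans hl h)
              · exact hT'.laminar (hT'.trans hk h) hl
  obtain ⟨F, hF, hFT, -⟩ := Tn.exists_isNested
  refine ⟨F, hF, fun v => ?_, by rw [hFT, Tl]⟩
  ext u
  rw [hFT]
  exact (Tc u v).symm

section Fibre

variable {F : Forest (Fin (n + 1))} {F' : Forest (Fin n)}

lemma IsNested.upperSet_subset (hF : IsNested G F) (hR : Restricts F F') :
    upperSet F ⊆ attachSet G F' := by
  intro v hv
  obtain ⟨x, hx, hadj⟩ := (hF.nesting.tube v.castSucc).exists_adj hv (mem_subtree_self F _)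
    (Fin.castSucc_lt_last v).ne
  induction x using Fin.lastCases with
  | last => exact absurd hadj (G.loopless.irrefl _)
  | cast x => exact ⟨x, hR.mem_iff.1 hx, hadj⟩

/-- The vertices above some neighbour of the last vertex form a chain. -/
lemma attachSet_chain (hG : IsPEO G) (hF' : IsNested (G.comap Fin.castSucc) F') {a b : Fin n}
    (ha : a ∈ attachSet G F') (hb : b ∈ attachSet G F') :
    a ∈ subtree F' b ∨ b ∈ subtree F' a := by
  have hT' := hF'.nesting
  obtain ⟨k, hk, hkz⟩ := ha
  obtain ⟨l, hl, hlz⟩ := hb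
  by_cases hkl : k = l
  · exact hT'.laminar hk (hkl ▸ hl)
  · rcases hT'.comp (G := G.comap Fin.castSucc) (hG.adj_of_adj_last hkz hlz hkl) with h | h
    · exact hT'.laminar hk (hT'.trans hl h)
    · exact hT'.laminar (hT'.trans hk h) hl

lemma IsNested.exists_adj_last (hF : IsNested G F) {x : Fin n}
    (hx : x.castSucc ∈ subtree F (Fin.last n)) :
    ∃ k : Fin n, k.castSucc ∈ subtree F (Fin.last n) ∧ G.Adj (Fin.last n) k.castSucc := by
  obtain ⟨k, hk, hadj⟩ := (hF.nesting.tube (Fin.last n)).exists_adj (mem_subtree_self F _) hx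
    (Fin.castSucc_lt_last x).ne
  induction k using Fin.lastCases with
  | last => exact absurd hadj (G.loopless.irrefl _)
  | cast k => exact ⟨k, hk, hadj⟩

/-- A neighbour of the last vertex is above or below it, so members of the attachment chain that are
not above it are below it. Thus `F` is determined by `F'` and `upperSet F`. -/
lemma IsNested.mem_subtree_last_iff (hG : IsPEO G) (hF : IsNested G F)
    (hF' : IsNested (G.comap Fin.castSucc) F') (hR : Restricts F F') {x : Fin n} :
    x.castSucc ∈ subtree F (Fin.last n) ↔
      ∃ a ∈ attachSet G F' \ upperSet F, x ∈ subtree F' a := by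
  have hT := hF.nesting
  constructor
  · intro hx
    obtain ⟨t, ht, hsub⟩ := hF'.nesting.exists_top
      ((hT.tube (Fin.last n)).preimage_castSucc hG hx)
    obtain ⟨k, hk, hadj⟩ := hF.exists_adj_last hx
    refine ⟨t, ⟨⟨k, hsub hk, hadj⟩, fun htU => ?_⟩, hsub hx⟩
    exact (Fin.castSucc_lt_last t).ne (hT.antisymm ht htU)
  · rintro ⟨a, ⟨⟨k, hk, hadj⟩, haU⟩, hxa⟩
    have hka := hR.mem_iff.2 hk
    have hkz : k.castSucc ∈ subtree F (Fin.last n) := by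
      rcases hT.comp hadj with h | h
      · exact absurd (hT.trans hka h) haU
      · exact h
    rcases hT.laminar hkz hka with h | h
    · exact absurd h haU
    · exact hT.trans h (hR.mem_iff.2 hxa)

/-- The position of the last vertex in the forest: the number of vertices above it. -/
noncomputable def depth (F : Forest (Fin (n + 1))) : ℕ := (upperSet F).ncard

/-- The largest possible depth of the last vertex in a forest that restricts to `F'`. -/
noncomputable def maxDepth (G : SimpleGraph (Fin (n + 1))) (F' : Forest (Fin n)) : ℕ :=
  (attachSet G F').ncard

lemma IsNested.depth_le (hF : IsNested G F) (hR : Restricts F F') : depth F ≤ maxDepth G F' :=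
  Set.ncard_le_ncard (hF.upperSet_subset hR)

/-- The upper sets are top segments of the chain `attachSet G F'`; two of them are nested, so equal
size makes them equal. -/
lemma eq_of_depth_eq (hG : IsPEO G) (hF' : IsNested (G.comap Fin.castSucc) F')
    {F₁ F₂ : Forest (Fin (n + 1))} (h₁ : IsNested G F₁) (h₂ : IsNested G F₂)
    (hR₁ : Restricts F₁ F') (hR₂ : Restricts F₂ F') (hd : depth F₁ = depth F₂) : F₁ = F₂ := by
  have hU : upperSet F₁ = upperSet F₂ := by
    by_cases h : upperSet F₁ ⊆ upperSet F₂
    · exact Set.eq_of_subset_of_ncard_le h hd.ge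
    by_cases h' : upperSet F₂ ⊆ upperSet F₁
    · exact (Set.eq_of_subset_of_ncard_le h' hd.le).symm
    exfalso
    rw [Set.not_subset] at h h'
    obtain ⟨u, hu1, hu2⟩ := h
    obtain ⟨v, hv2, hv1⟩ := h'
    rcases attachSet_chain hG hF' (h₁.upperSet_subset hR₁ hu1) (h₂.upperSet_subset hR₂ hv2)
      with h | h
    · exact hv1 (subtree_trans (hR₁.mem_iff.2 h) hu1)
    · exact hu2 (subtree_trans (hR₂.mem_iff.2 h) hv2)
  refine h₁.ext h₂ (funext fun v => Set.ext fun x => ?_)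
  induction v using Fin.lastCases with
  | last =>
    induction x using Fin.lastCases with
    | last => simp only [mem_subtree_self]
    | cast x =>
      rw [h₁.mem_subtree_last_iff hG hF' hR₁, h₂.mem_subtree_last_iff hG hF' hR₂, hU]
  | cast v =>
    induction x using Fin.lastCases with
    | last => exact Set.ext_iff.1 hU v
    | cast x => rw [hR₁.mem_iff, hR₂.mem_iff]

/-- Removing a simplicial vertex keeps the subtree of `i` connected, so `i` loses the last vertex
and nothing else. -/
lemma IsSwap.restricts (hG : IsPEO G) {F₂ : Forest (Fin (n + 1))} (hF : IsNested G F)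
    (hF₂ : IsNested G F₂) {i : Fin n}
    (hs : IsSwap (subtree F) (subtree F₂) i.castSucc (Fin.last n)) :
    (∀ F', Restricts F F' → Restricts F₂ F') ∧ depth F₂ + 1 = depth F := by
  have hT := hF.nesting
  have hi : subtree F₂ i.castSucc = subtree F i.castSucc \ {Fin.last n} := by
    rw [hs.eq_componentOf hT hF₂.nesting]
    refine Set.Subset.antisymm (componentOf_subset _ _) ?_
    have e : subtree F i.castSucc \ {Fin.last n} =
        Fin.castSucc '' (Fin.castSucc ⁻¹' subtree F i.castSucc) := by
      ext x
      induction x using Fin.lastCases with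
      | last => simp [fun u : Fin n => (Fin.castSucc_lt_last u).ne]
      | cast x => simp [(Fin.castSucc_lt_last x).ne]
    have ht : IsTube G (subtree F i.castSucc \ {Fin.last n}) := by
      rw [e]
      exact ((hT.tube _).preimage_castSucc hG (mem_subtree_self F _)).image_castSucc
    have hmem : i.castSucc ∈ subtree F i.castSucc \ {Fin.last n} :=
      ⟨mem_subtree_self F _, (Fin.castSucc_lt_last i).ne⟩
    exact ht.subset_componentOf subset_rfl hmem (mem_componentOf_self hmem)
  have ho : ∀ v : Fin n, v ≠ i → subtree F₂ v.castSucc = subtree F v.castSucc := fun v hv =>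
    hs.eq_of_ne _ (fun h => hv (Fin.castSucc_injective n h)) (Fin.castSucc_lt_last v).ne
  constructor
  · intro F' hR v
    rw [hR v]
    by_cases hv : v = i
    · subst hv
      rw [hi]
      ext x
      simp [(Fin.castSucc_lt_last x).ne]
    · rw [ho v hv]
  · have hU : upperSet F₂ = upperSet F \ {i} := by
      ext v
      simp only [upperSet, Set.mem_ofPred_eq, Set.mem_sdiff, Set.mem_singleton_iff]
      by_cases hv : v = i
      · subst hv
        simp [hi]
      · simp [ho v hv, hv]
    have hiT := hs.mem hF₂.nesting
    have hiU : i ∈ upperSet F := hiT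
    rw [depth, depth, hU]
    exact Set.ncard_sdiff_singleton_add_one hiU

lemma Flips.restricts_last (hG : IsPEO G) {F₂ : Forest (Fin (n + 1))} {i : Fin n}
    (hF' : IsNested (G.comap Fin.castSucc) F')
    (h : Flips G F F₂ i.castSucc (Fin.last n)) (hR : Restricts F F') :
    Restricts F₂ F' ∧ (depth F₂ + 1 = depth F ∨ depth F + 1 = depth F₂) := by
  rcases h.swap with hs | hs
  · obtain ⟨h1, h2⟩ := hs.restricts hG h.left h.right
    exact ⟨h1 F' hR, Or.inl h2⟩
  · obtain ⟨h1, h2⟩ := hs.symm.restricts hG h.right h.left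
    obtain ⟨F'', hF'', hR''⟩ := h.right.exists_restricts hG
    have := (h1 F'' hR'').unique hF'' hF' hR
    exact ⟨this ▸ hR'', Or.inr h2⟩

lemma IsNested.exists_flips_last (hG : IsPEO G) (hF : IsNested G F) {h : ℕ}
    (hd : depth F = h + 1) :
    ∃ (i : Fin n) (F₂ : Forest (Fin (n + 1))), Flips G F F₂ i.castSucc (Fin.last n) ∧
      (∀ F', Restricts F F' → Restricts F₂ F') ∧ depth F₂ = h := by
  have hne : (upperSet F).Nonempty := by
    rw [← Set.ncard_pos]
    have : (upperSet F).ncard = h + 1 := hd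
    omega
  obtain ⟨v, hv⟩ := hne
  rcases mem_subtree_iff.1 hv with h' | ⟨p, hp, -⟩
  · exact absurd h'.symm (Fin.castSucc_lt_last v).ne
  induction p using Fin.lastCases with
  | last => exact absurd hp (hF.irrefl _)
  | cast i =>
    obtain ⟨h1, h2⟩ := hF.rotate hp
    obtain ⟨h3, h4⟩ := h2.restricts hG hF h1
    exact ⟨i, _, ⟨hF, h1, Or.inl h2⟩, h3, by omega⟩

/-- The two extreme positions of the last vertex: as a root (`true`) or as a leaf (`false`). -/
def IsEnd (G : SimpleGraph (Fin (n + 1))) (b : Bool) (F : Forest (Fin (n + 1))) : Prop :=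
  subtree F (Fin.last n) = if b then componentOf G Set.univ (Fin.last n) else {Fin.last n}

lemma IsNested.isEnd_true_iff (hF : IsNested G F) : IsEnd G true F ↔ upperSet F = ∅ := by
  have hT := hF.nesting
  rw [IsEnd, if_pos rfl, Set.eq_empty_iff_forall_notMem]
  constructor
  · intro h v hv
    have := (hT.tube v.castSucc).subset_componentOf (Set.subset_univ _) hv
      (mem_componentOf_self (Set.mem_univ _)) (hT.refl _)
    rw [← h] at this
    exact (Fin.castSucc_lt_last v).ne (hT.antisymm this hv)
  · intro h
    refine Set.Subset.antisymm ((hT.tube _).subset_componentOf (Set.subset_univ _) (hT.refl _)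
      (mem_componentOf_self (Set.mem_univ _))) ?_
    refine (isTube_componentOf (Set.mem_univ _)).subset_of_closed
      (mem_componentOf_self (Set.mem_univ _)) (hT.refl _) ?_
    intro x y _ _ hadj hx
    rcases hT.comp hadj with h' | h'
    · rcases hT.laminar hx h' with h'' | h''
      · induction y using Fin.lastCases with
        | last => exact hT.refl _
        | cast y => exact absurd h'' (h y)
      · exact h''
    · exact hT.trans hx h'

lemma IsNested.isEnd_false_iff (hF : IsNested G F) (hR : Restricts F F') :
    IsEnd G false F ↔ upperSet F = attachSet G F' := by
  have hT := hF.nesting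
  rw [IsEnd, if_neg Bool.false_ne_true]
  constructor
  · intro h
    refine Set.Subset.antisymm (hF.upperSet_subset hR) ?_
    rintro v ⟨k, hk, hadj⟩
    rcases hT.comp hadj with h' | h'
    · exact hT.trans (hR.mem_iff.2 hk) h'
    · rw [h] at h'
      exact absurd h' (Fin.castSucc_lt_last k).ne
  · intro h
    ext x
    induction x using Fin.lastCases with
    | last => simp [mem_subtree_self]
    | cast x =>
      simp only [Set.mem_singleton_iff, (Fin.castSucc_lt_last x).ne, iff_false]
      intro hx
      obtain ⟨k, hk, hadj⟩ := hF.exists_adj_last hx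
      have hk' : k ∈ upperSet F := by
        rw [h]
        exact ⟨k, mem_subtree_self F' k, hadj⟩
      exact (Fin.castSucc_lt_last k).ne (hT.antisymm hk hk')

/-- The depth of the last vertex in its extreme positions. -/
noncomputable def endDepth (G : SimpleGraph (Fin (n + 1))) (b : Bool) (F' : Forest (Fin n)) : ℕ :=
  if b then 0 else maxDepth G F'

lemma IsNested.isEnd_iff (hF : IsNested G F) (hR : Restricts F F') {b : Bool} :
    IsEnd G b F ↔ depth F = endDepth G b F' := by
  cases b with
  | true => rw [hF.isEnd_true_iff, endDepth, if_pos rfl, depth, Set.ncard_eq_zero]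
  | false =>
    rw [hF.isEnd_false_iff hR, endDepth, if_neg Bool.false_ne_true]
    exact ⟨fun h => congrArg Set.ncard h, fun h =>
      Set.eq_of_subset_of_ncard_le (hF.upperSet_subset hR) h.ge⟩

/-- At an extreme position the subtree of `v` depends only on the set `subtree F' v`, so equalities
between subtrees in the smaller graph lift to `G`. -/
lemma IsNested.subtree_castSucc_of_isEnd (hF : IsNested G F) (hR : Restricts F F') {b : Bool}
    (hb : IsEnd G b F) (v : Fin n) :
    subtree F v.castSucc = Fin.castSucc '' subtree F' v ∪
      {z | z = Fin.last n ∧ b = false ∧ ∃ k ∈ subtree F' v, G.Adj (Fin.last n) k.castSucc} := by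
  ext x
  induction x using Fin.lastCases with
  | cast x => simp [hR.mem_iff, (Fin.castSucc_lt_last x).ne]
  | last =>
    have e : Fin.last n ∈ subtree F v.castSucc ↔ v ∈ upperSet F := Iff.rfl
    rw [e]
    cases b with
    | true =>
      rw [hF.isEnd_true_iff] at hb
      simp [hb, fun u : Fin n => (Fin.castSucc_lt_last u).ne]
    | false =>
      rw [hF.isEnd_false_iff hR] at hb
      simp [hb, fun u : Fin n => (Fin.castSucc_lt_last u).ne, attachSet]

lemma IsSwap.castSucc {F₂ : Forest (Fin (n + 1))} {F₂' : Forest (Fin n)} (hF : IsNested G F)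
    (hF₂ : IsNested G F₂) (hR : Restricts F F') (hR₂ : Restricts F₂ F₂') {b : Bool}
    (hb : IsEnd G b F) (hb₂ : IsEnd G b F₂) {i j : Fin n}
    (hs : IsSwap (subtree F') (subtree F₂') i j) :
    IsSwap (subtree F) (subtree F₂) i.castSucc j.castSucc := by
  refine ⟨fun h => hs.ne (Fin.castSucc_injective n h), ?_, fun v hi hj => ?_⟩
  · rw [hF.subtree_castSucc_of_isEnd hR hb, hF₂.subtree_castSucc_of_isEnd hR₂ hb₂, hs.eq]
  · induction v using Fin.lastCases with
    | last => exact Eq.trans hb₂ hb.symm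
    | cast v =>
      rw [hF.subtree_castSucc_of_isEnd hR hb, hF₂.subtree_castSucc_of_isEnd hR₂ hb₂,
        hs.eq_of_ne v (fun h => hi (h ▸ rfl)) (fun h => hj (h ▸ rfl))]

/-- Rotations of smaller vertices lift to forests in which the last vertex is extreme. -/
lemma Flips.castSucc {F₂ : Forest (Fin (n + 1))} {F₂' : Forest (Fin n)} (hF : IsNested G F)
    (hF₂ : IsNested G F₂) (hR : Restricts F F') (hR₂ : Restricts F₂ F₂') {b : Bool}
    (hb : IsEnd G b F) (hb₂ : IsEnd G b F₂) {i j : Fin n}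
    (h : Flips (G.comap Fin.castSucc) F' F₂' i j) :
    Flips G F F₂ i.castSucc j.castSucc :=
  ⟨hF, hF₂, h.swap.imp (fun hs => hs.castSucc hF hF₂ hR hR₂ hb hb₂)
    fun hs => hs.castSucc hF hF₂ hR hR₂ hb hb₂⟩

lemma IsSwap.of_castSucc {F₂ : Forest (Fin (n + 1))} {F₂' : Forest (Fin n)}
    (hR : Restricts F F') (hR₂ : Restricts F₂ F₂') {i j : Fin n}
    (hs : IsSwap (subtree F) (subtree F₂) i.castSucc j.castSucc) :
    IsSwap (subtree F') (subtree F₂') i j :=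
  ⟨fun h => hs.ne (h ▸ rfl), by rw [hR i, hR₂ j, hs.eq], fun v hi hj => by
    rw [hR v, hR₂ v, hs.eq_of_ne _ (fun h => hi (Fin.castSucc_injective n h))
      (fun h => hj (Fin.castSucc_injective n h))]⟩

lemma Flips.of_castSucc {F₂ : Forest (Fin (n + 1))} {F₂' : Forest (Fin n)}
    (hF' : IsNested (G.comap Fin.castSucc) F') (hF₂' : IsNested (G.comap Fin.castSucc) F₂')
    (hR : Restricts F F') (hR₂ : Restricts F₂ F₂') {i j : Fin n}
    (h : Flips G F F₂ i.castSucc j.castSucc) : Flips (G.comap Fin.castSucc) F' F₂' i j :=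
  ⟨hF', hF₂', h.swap.imp (fun hs => hs.of_castSucc hR hR₂) fun hs => hs.of_castSucc hR hR₂⟩

lemma Flips.isEnd {F₂ : Forest (Fin (n + 1))} {i j : Fin n}
    (h : Flips G F F₂ i.castSucc j.castSucc) {b : Bool} (hb : IsEnd G b F) : IsEnd G b F₂ := by
  rw [IsEnd, h.subtree_eq (Fin.castSucc_lt_last i).ne' (Fin.castSucc_lt_last j).ne']
  exact hb

/-- Start with the last vertex as a leaf, at maximal depth, and rotate it upwards one step at a
time. -/
lemma exists_of_depth_le (hG : IsPEO G) (hF' : IsNested (G.comap Fin.castSucc) F') {h : ℕ}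
    (hh : h ≤ maxDepth G F') : ∃ F, IsNested G F ∧ Restricts F F' ∧ depth F = h := by
  induction hh using Nat.decreasingInduction with
  | self =>
    obtain ⟨F, hF, hR, hl⟩ := exists_restricts_leaf hG hF'
    have := (hF.isEnd_iff hR (b := false)).1 (by rw [IsEnd, hl]; rfl)
    exact ⟨F, hF, hR, this⟩
  | of_succ k _ ih =>
    obtain ⟨F, hF, hR, hd⟩ := ih
    obtain ⟨i, F₂, hf, hR₂, hd₂⟩ := hF.exists_flips_last hG hd
    exact ⟨F₂, hf.right, hR₂ F' hR, hd₂⟩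

end Fibre

end LastVertex

/-! ### The initial forest -/

lemma find?_reverse_finRange_eq_some {n : ℕ} {p : Fin n → Bool} {u : Fin n} (hu : p u = true)
    (hmax : ∀ v, u < v → p v = false) : (List.finRange n).reverse.find? p = some u := by
  rcases h : (List.finRange n).reverse.find? p with _ | w
  · rw [List.find?_eq_none] at h
    exact absurd hu (h u (by simp))
  · obtain ⟨hw, as, bs, hl, has⟩ := List.find?_eq_some_iff_append.1 h
    rcases lt_trichotomy u w with h' | h' | h'
    · rw [hmax w h'] at hw
      exact absurd hw Bool.false_ne_true
    · rw [h']
    · exfalso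
      have hsort : (List.finRange n).reverse.Pairwise (· > ·) := by
        rw [List.pairwise_reverse]
        exact List.pairwise_lt_finRange n
      have hmem : u ∈ (List.finRange n).reverse := by simp
      rw [hl] at hsort hmem
      rcases List.mem_append.1 hmem with hm | hm
      · have := has u hm
        simp [hu] at this
      · have h2 := (List.pairwise_append.1 hsort).2.1
        rcases List.mem_cons.1 hm with rfl | hm
        · exact lt_irrefl _ h'
        · exact lt_asymm h' ((List.pairwise_cons.1 h2).1 u hm)

section Initial

variable {n : ℕ} (G : SimpleGraph (Fin n))

/-- In this nesting subtrees contain only larger vertices, so the nearest proper ancestor is the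
largest one, which the search from the top finds. -/
lemma isParent_initialForest (v : Fin n) :
    IsParent (fun u => componentOf G {w | u ≤ w} u) v (initialForest G v) := by
  classical
  have hN := isNesting_componentOf G (f := (id : Fin n → Fin n)) Function.injective_id
  have hp : ∀ u, (u < v ∧ ∃ C, IsComponent G {w | u ≤ w} C ∧ u ∈ C ∧ v ∈ C) ↔
      u ≠ v ∧ v ∈ componentOf G {w | u ≤ w} u := by
    intro u
    constructor
    · rintro ⟨h, C, hC, hu, hv⟩
      exact ⟨h.ne, hC.eq_componentOf hu ▸ hv⟩
    · rintro ⟨h, hv⟩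
      exact ⟨lt_of_le_of_ne (componentOf_subset _ _ hv : v ∈ {w | u ≤ w}) h, _,
        isComponent_componentOf (le_refl u : u ∈ {w | u ≤ w}),
        mem_componentOf_self (le_refl u : u ∈ {w | u ≤ w}), hv⟩
  obtain ⟨o, ho⟩ := hN.exists_isParent v
  suffices h : initialForest G v = o by
    rw [h]
    exact ho
  unfold initialForest
  rcases o with _ | p
  · rw [List.find?_eq_none]
    intro u _
    rw [decide_eq_true_iff, hp]
    exact fun h => h.1 (ho u h.2)
  · refine find?_reverse_finRange_eq_some ?_ ?_
    · rw [decide_eq_true_iff, hp]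
      exact ⟨ho.2.1, ho.1⟩
    · intro u hu
      rw [decide_eq_false_iff_not, hp]
      rintro ⟨huv, hv⟩
      have := (ho.2.2 u hv).resolve_left huv
      exact absurd (componentOf_subset _ _ this : p ∈ {w | u ≤ w}) (not_le.2 hu)

lemma isNested_initialForest : IsNested G (initialForest G) ∧
    ∀ u v, u ∈ subtree (initialForest G) v → v ≤ u := by
  have hN := isNesting_componentOf G (f := (id : Fin n → Fin n)) Function.injective_id
  obtain ⟨h1, h2⟩ := hN.isNested (isParent_initialForest G)
  refine ⟨h1, fun u v h => ?_⟩
  rw [h2] at h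
  exact (componentOf_subset _ _ h : u ∈ {w | v ≤ w})

lemma initialForest_unique {F : Forest (Fin n)} (hF : IsNested G F)
    (h : ∀ u v, u ∈ subtree F v → v ≤ u) : F = initialForest G :=
  hF.eq_of_monotone (f := (id : Fin n → Fin n)) Function.injective_id
    (isNested_initialForest G).1 h (isNested_initialForest G).2

end Initial

lemma restricts_initialForest {n : ℕ} {G : SimpleGraph (Fin (n + 1))} (hG : IsPEO G) :
    Restricts (initialForest G) (initialForest (G.comap Fin.castSucc)) ∧
      IsEnd G false (initialForest G) := by
  obtain ⟨hF, hm⟩ := isNested_initialForest G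
  constructor
  · obtain ⟨F', hF', hR⟩ := hF.exists_restricts hG
    have : F' = initialForest (G.comap Fin.castSucc) :=
      initialForest_unique _ hF' fun u v h => hm _ _ (hR.mem_iff.2 h)
    exact this ▸ hR
  · refine Set.Subset.antisymm (fun x hx => ?_) ?_
    · exact Fin.last_le_iff.1 (hm _ _ hx)
    · rintro x (rfl : x = Fin.last n)
      exact mem_subtree_self _ _

/-! ### The greedy rule as a condition on a list, and its agreement with the algorithm. -/

section Greedy

variable {n : ℕ} {G : SimpleGraph (Fin n)}

/-- The greedy rule leads from `F` to `F₂` if `W` is the set of visited forests. -/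
def IsStep (G : SimpleGraph (Fin n)) (W : Set (Forest (Fin n))) (F F₂ : Forest (Fin n)) : Prop :=
  ∃ i j, i < j ∧ Flips G F F₂ i j ∧ F₂ ∉ W ∧
    (∀ i' j' F₃, j < j' → i' < j' → Flips G F F₃ i' j' → F₃ ∈ W) ∧
    ∀ i' F₃, i' < j → Flips G F F₃ i' j → F₃ ∉ W → F₃ = F₂

/-- The greedy rule visits the forests of the list in order if `W` has been visited before. -/
def IsGreedy (G : SimpleGraph (Fin n)) : Set (Forest (Fin n)) → List (Forest (Fin n)) → Prop
  | _, [] => True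
  | _, [_] => True
  | W, F :: F₂ :: L => IsStep G (insert F W) F F₂ ∧ IsGreedy G (insert F W) (F₂ :: L)

lemma IsGreedy.nodup {W : Set (Forest (Fin n))} {F : Forest (Fin n)} {L : List (Forest (Fin n))}
    (h : IsGreedy G W (F :: L)) (hF : F ∉ W) : (F :: L).Nodup ∧ ∀ x ∈ F :: L, x ∉ W := by
  induction L generalizing W F with
  | nil => simpa using hF
  | cons F₂ L ih =>
    obtain ⟨⟨i, j, -, -, hF₂, -⟩, h'⟩ := h
    obtain ⟨h1, h2⟩ := ih h' hF₂
    refine ⟨List.nodup_cons.2 ⟨fun hm => h2 F hm (Set.mem_insert _ _), h1⟩, fun x hx => ?_⟩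
    rcases List.mem_cons.1 hx with rfl | hx
    · exact hF
    · exact fun hW => h2 x hx (Set.mem_insert_of_mem _ hW)

lemma IsGreedy.isChain {W : Set (Forest (Fin n))} {L : List (Forest (Fin n))}
    (h : IsGreedy G W L) : L.IsChain fun F F' => ∃ i j, Flips G F F' i j := by
  induction L generalizing W with
  | nil => exact List.isChain_nil
  | cons F L ih =>
    cases L with
    | nil => exact List.isChain_singleton _
    | cons F₂ L =>
      obtain ⟨⟨i, j, -, hf, -⟩, h'⟩ := h
      exact List.isChain_cons_cons.2 ⟨⟨i, j, hf⟩, ih h'⟩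

/-- For gluing consecutive sweeps: the step across the seam and the second run are judged with the
whole first run already visited. -/
lemma IsGreedy.append {W : Set (Forest (Fin n))} {A B : List (Forest (Fin n))}
    {F F₂ : Forest (Fin n)} (hA : IsGreedy G W (A ++ [F]))
    (hs : IsStep G (W ∪ {x | x ∈ A ++ [F]}) F F₂)
    (hB : IsGreedy G (W ∪ {x | x ∈ A ++ [F]}) (F₂ :: B)) :
    IsGreedy G W ((A ++ [F]) ++ F₂ :: B) := by
  have e : ∀ (X : Forest (Fin n)) (L : List (Forest (Fin n))),
      W ∪ {x | x ∈ X :: L} = insert X W ∪ {x | x ∈ L} := by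
    intro X L
    ext x
    simp only [Set.mem_union, Set.mem_ofPred_eq, List.mem_cons, Set.mem_insert_iff]
    tauto
  induction A generalizing W with
  | nil =>
    have e' : W ∪ {x | x ∈ [] ++ [F]} = insert F W := by
      ext x
      simp [or_comm]
    rw [e'] at hs hB
    exact ⟨hs, hB⟩
  | cons X A ih =>
    rw [List.cons_append, e] at hs hB
    cases A with
    | nil =>
      exact ⟨hA.1, ih hA.2 hs hB (fun _ _ => by
        ext x
        simp only [Set.mem_union, Set.mem_ofPred_eq, List.mem_cons, Set.mem_insert_iff]
        tauto)⟩
    | cons Y A =>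
      exact ⟨hA.1, ih hA.2 hs hB (fun _ _ => by
        ext x
        simp only [Set.mem_union, Set.mem_ofPred_eq, List.mem_cons, Set.mem_insert_iff]
        tauto)⟩

lemma isGreedy_map_range' {W : Set (Forest (Fin n))} {f : ℕ → Forest (Fin n)} {m : ℕ}
    (h : ∀ t < m, IsStep G (W ∪ f '' Set.Iio (t + 1)) (f t) (f (t + 1))) (k a : ℕ)
    (hk : a + k = m) : IsGreedy G (W ∪ f '' Set.Iio a) ((List.range' a (k + 1)).map f) := by
  induction k generalizing a with
  | zero => simp [IsGreedy]
  | succ k ih =>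
    have e : insert (f a) (W ∪ f '' Set.Iio a) = W ∪ f '' Set.Iio (a + 1) := by
      rw [← Order.succ_eq_add_one, Order.Iio_succ_eq_insert, Set.image_insert_eq,
        Set.union_insert]
    have h1 := h a (by omega)
    have h2 := ih (a + 1) (by omega)
    rw [List.range'_succ] at h2 ⊢
    rw [List.range'_succ]
    rw [← e] at h1 h2
    exact ⟨h1, h2⟩

lemma mem_moves {visited : List (Forest (Fin n))} {F : Forest (Fin n)} (hF : IsNested G F)
    {i j : Fin n} :
    i ∈ moves G visited F j ↔ i < j ∧ ∃ F₂, Flips G F F₂ i j ∧ F₂ ∉ visited := by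
  simp only [moves, List.mem_filter, List.mem_finRange, true_and, decide_eq_true_eq, hF.flips_iff]
  refine and_congr_right fun _ => ?_
  constructor
  · rintro ⟨h1, h2⟩
    exact ⟨_, ⟨h1, rfl⟩, h2⟩
  · rintro ⟨_, ⟨h1, rfl⟩, h2⟩
    exact ⟨h1, h2⟩

lemma IsStep.nextForest_eq {A : List (Forest (Fin n))} {F F₂ : Forest (Fin n)}
    (h : IsStep G {x | x ∈ A ++ [F]} F F₂) : nextForest G (A ++ [F]) = some F₂ := by
  classical
  obtain ⟨i, j, hij, hf, hF₂, hgt, huniq⟩ := h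
  have hF := hf.left
  have hmoves : moves G (A ++ [F]) F j = [i] := by
    refine List.perm_singleton.1 ((List.perm_ext_iff_of_nodup
      ((List.nodup_finRange n).filter _) (List.nodup_singleton i)).2 fun x => ?_)
    rw [List.mem_singleton]
    refine (mem_moves hF).trans ⟨?_, ?_⟩
    · rintro ⟨hx, F₃, hf₃, hF₃⟩
      have := huniq x F₃ hx hf₃ hF₃
      exact (this ▸ hf₃).eq_left hf
    · rintro rfl
      exact ⟨hij, F₂, hf, hF₂⟩
  have hfind : (List.finRange n).reverse.find?
      (fun j => decide (moves G (A ++ [F]) F j ≠ [])) = some j := by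
    refine find?_reverse_finRange_eq_some ?_ fun j' hj' => ?_
    · rw [decide_eq_true_iff, hmoves]
      exact List.cons_ne_nil _ _
    · rw [decide_eq_false_iff_not, not_not, List.eq_nil_iff_forall_not_mem]
      intro x hx
      obtain ⟨hx', F₃, hf₃, hF₃⟩ := (mem_moves hF).1 hx
      exact hF₃ (hgt x j' F₃ hj' hx' hf₃)
  unfold nextForest
  rw [List.getLast?_concat]
  simp only [hfind, hmoves, (hF.flips_iff.1 hf).2]

lemma IsGreedy.exists_algorithmR {F₀ F : Forest (Fin n)} {A L : List (Forest (Fin n))}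
    (h : IsGreedy G {x | x ∈ A} (F :: L)) {k : ℕ} (hk : algorithmR G F₀ k = A ++ [F]) :
    ∃ k', algorithmR G F₀ k' = A ++ F :: L := by
  induction L generalizing A F k with
  | nil => exact ⟨k, hk⟩
  | cons F₂ L ih =>
    have e : insert F {x | x ∈ A} = {x | x ∈ A ++ [F]} := by
      ext x
      simp [or_comm]
    obtain ⟨hs, h'⟩ := h
    rw [e] at hs h'
    obtain ⟨k', hk'⟩ := ih h' (k := k + 1) (by rw [algorithmR, hk, hs.nextForest_eq])
    exact ⟨k', by rw [hk', List.append_assoc, List.singleton_append]⟩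

lemma nextForest_eq_none {L : List (Forest (Fin n))} (hL : ∀ F, F ∈ L ↔ IsNested G F) :
    nextForest G L = none := by
  classical
  unfold nextForest
  rcases h : L.getLast? with _ | F
  · rfl
  · have hF := (hL F).1 (List.mem_of_getLast? h)
    have hm : ∀ j, moves G L F j = [] := by
      intro j
      rw [List.eq_nil_iff_forall_not_mem]
      intro i hi
      obtain ⟨-, F₂, hf, hF₂⟩ := (mem_moves hF).1 hi
      exact hF₂ ((hL F₂).2 hf.right)
    have hfind : (List.finRange n).reverse.find? (fun j => decide (moves G L F j ≠ [])) = none := by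
      simp [hm]
    simp only [hfind]

end Greedy

/-! ### Lifting a greedy run from the graph without its last vertex. -/

section Zigzag

variable {n : ℕ} {G : SimpleGraph (Fin (n + 1))}

/-- The forest obtained from `F'` by inserting the last vertex at depth `h`. -/
noncomputable def insertAt (G : SimpleGraph (Fin (n + 1))) (F' : Forest (Fin n)) (h : ℕ) :
    Forest (Fin (n + 1)) :=
  Classical.epsilon fun F => IsNested G F ∧ Restricts F F' ∧ depth F = h

lemma insertAt_spec (hG : IsPEO G) {F' : Forest (Fin n)}
    (hF' : IsNested (G.comap Fin.castSucc) F') {h : ℕ} (hh : h ≤ maxDepth G F') :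
    IsNested G (insertAt G F' h) ∧ Restricts (insertAt G F' h) F' ∧ depth (insertAt G F' h) = h :=
  Classical.epsilon_spec (exists_of_depth_le hG hF' hh)

lemma IsNested.eq_insertAt (hG : IsPEO G) {F : Forest (Fin (n + 1))} (hF : IsNested G F)
    {F' : Forest (Fin n)} (hF' : IsNested (G.comap Fin.castSucc) F') (hR : Restricts F F') {h : ℕ}
    (hd : depth F = h) : F = insertAt G F' h := by
  obtain ⟨h1, h2, h3⟩ := insertAt_spec hG hF' (hd ▸ hF.depth_le hR)
  exact eq_of_depth_eq hG hF' hF h1 hR h2 (hd.trans h3.symm)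

/-- The depths of the last vertex in a sweep that starts with the vertex as a root (`true`) or as a
leaf (`false`). -/
def sweepDepth (b : Bool) (m t : ℕ) : ℕ := if b then t else m - t

lemma sweepDepth_le {b : Bool} {m t : ℕ} (h : t ≤ m) : sweepDepth b m t ≤ m := by
  unfold sweepDepth
  split_ifs <;> omega

lemma sweepDepth_inj {b : Bool} {m s t : ℕ} (hs : s ≤ m) (ht : t ≤ m)
    (h : sweepDepth b m s = sweepDepth b m t) : s = t := by
  unfold sweepDepth at h
  split_ifs at h <;> omega

/-- All forests that restrict to `F'`, in the order of the position of the last vertex. -/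
noncomputable def sweep (G : SimpleGraph (Fin (n + 1))) (b : Bool) (F' : Forest (Fin n)) :
    List (Forest (Fin (n + 1))) :=
  (List.range (maxDepth G F' + 1)).map fun t => insertAt G F' (sweepDepth b (maxDepth G F') t)

lemma mem_sweep (hG : IsPEO G) {b : Bool} {F' : Forest (Fin n)}
    (hF' : IsNested (G.comap Fin.castSucc) F') {F : Forest (Fin (n + 1))} :
    F ∈ sweep G b F' ↔ IsNested G F ∧ Restricts F F' := by
  simp only [sweep, List.mem_map, List.mem_range]
  constructor
  · rintro ⟨t, ht, rfl⟩
    obtain ⟨h1, h2, -⟩ := insertAt_spec hG hF' (sweepDepth_le (b := b) (Nat.lt_succ_iff.1 ht))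
    exact ⟨h1, h2⟩
  · rintro ⟨hF, hR⟩
    have hle := hF.depth_le hR
    refine ⟨sweepDepth b (maxDepth G F') (depth F), Nat.lt_succ_iff.2 (sweepDepth_le hle), ?_⟩
    refine (hF.eq_insertAt hG hF' hR ?_).symm
    unfold sweepDepth
    split_ifs <;> omega

lemma sweep_eq_cons (b : Bool) (F' : Forest (Fin n)) :
    ∃ B, sweep G b F' = insertAt G F' (endDepth G b F') :: B := by
  have e : endDepth G b F' = sweepDepth b (maxDepth G F') 0 := by
    cases b <;> simp [sweepDepth, endDepth]
  rw [e, sweep, List.range_succ_eq_map, List.map_cons]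
  exact ⟨_, rfl⟩

lemma sweep_eq_concat (b : Bool) (F' : Forest (Fin n)) :
    ∃ A, sweep G b F' = A ++ [insertAt G F' (endDepth G (!b) F')] := by
  have e : endDepth G (!b) F' = sweepDepth b (maxDepth G F') (maxDepth G F') := by
    cases b <;> simp [sweepDepth, endDepth]
  rw [e, sweep, List.range_succ, List.map_append, List.map_singleton]
  exact ⟨_, rfl⟩

lemma exists_flips_insertAt (hG : IsPEO G) {F' : Forest (Fin n)}
    (hF' : IsNested (G.comap Fin.castSucc) F') {h : ℕ} (hh : h + 1 ≤ maxDepth G F') :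
    ∃ i : Fin n, Flips G (insertAt G F' (h + 1)) (insertAt G F' h) i.castSucc (Fin.last n) := by
  obtain ⟨h1, h2, h3⟩ := insertAt_spec hG hF' hh
  obtain ⟨i, F₂, hf, hR, hd⟩ := h1.exists_flips_last hG h3
  exact ⟨i, hf.right.eq_insertAt hG hF' (hR F' h2) hd ▸ hf⟩

/-- The forests whose restrictions lie in `W`. -/
def fibre (G : SimpleGraph (Fin (n + 1))) (W : Set (Forest (Fin n))) :
    Set (Forest (Fin (n + 1))) :=
  {F | IsNested G F ∧ ∃ F' ∈ W, IsNested (G.comap Fin.castSucc) F' ∧ Restricts F F'}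

lemma mem_fibre_iff {W : Set (Forest (Fin n))} {F : Forest (Fin (n + 1))} {F' : Forest (Fin n)}
    (hF : IsNested G F) (hF' : IsNested (G.comap Fin.castSucc) F') (hR : Restricts F F') :
    F ∈ fibre G W ↔ F' ∈ W := by
  constructor
  · rintro ⟨-, F'', hW, hF'', hR''⟩
    rwa [hR.unique hF' hF'' hR'']
  · exact fun h => ⟨hF, F', h, hF', hR⟩

lemma fibre_insert (hG : IsPEO G) {b : Bool} {W : Set (Forest (Fin n))} {F' : Forest (Fin n)}
    (hF' : IsNested (G.comap Fin.castSucc) F') :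
    fibre G (insert F' W) = fibre G W ∪ {x | x ∈ sweep G b F'} := by
  ext F
  simp only [Set.mem_union, Set.mem_ofPred_eq, mem_sweep hG hF']
  constructor
  · rintro ⟨hF, F'', h, hF'', hR⟩
    rcases h with rfl | h
    · exact Or.inr ⟨hF, hR⟩
    · exact Or.inl ⟨hF, F'', h, hF'', hR⟩
  · rintro (⟨hF, F'', h, hF'', hR⟩ | ⟨hF, hR⟩)
    · exact ⟨hF, F'', Or.inr h, hF'', hR⟩
    · exact ⟨hF, F', Or.inl rfl, hF', hR⟩

lemma isGreedy_sweep (hG : IsPEO G) (b : Bool) {W : Set (Forest (Fin n))} {F' : Forest (Fin n)}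
    (hF' : IsNested (G.comap Fin.castSucc) F') (hW : F' ∉ W) :
    IsGreedy G (fibre G W) (sweep G b F') := by
  set m := maxDepth G F' with hm
  set f : ℕ → Forest (Fin (n + 1)) := fun t => insertAt G F' (sweepDepth b m t) with hf
  have spec : ∀ {t}, t ≤ m → IsNested G (f t) ∧ Restricts (f t) F' ∧
      depth (f t) = sweepDepth b m t := fun ht => insertAt_spec hG hF' (sweepDepth_le ht)
  have step : ∀ t < m, IsStep G (fibre G W ∪ f '' Set.Iio (t + 1)) (f t) (f (t + 1)) := by
    intro t ht
    obtain ⟨h1, h2, h3⟩ := spec ht.le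
    obtain ⟨h4, h5, h6⟩ := spec (Nat.succ_le_of_lt ht)
    have hflip : ∃ i : Fin n, Flips G (f t) (f (t + 1)) i.castSucc (Fin.last n) := by
      cases b with
      | true =>
        obtain ⟨i, hi⟩ := exists_flips_insertAt hG hF' (h := t) (Nat.succ_le_of_lt ht)
        exact ⟨i, hi.symm⟩
      | false =>
        obtain ⟨i, hi⟩ := exists_flips_insertAt hG hF' (h := m - (t + 1)) (by omega)
        have e : m - (t + 1) + 1 = m - t := by omega
        rw [e] at hi
        exact ⟨i, hi⟩
    obtain ⟨i, hi⟩ := hflip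
    refine ⟨i.castSucc, Fin.last n, Fin.castSucc_lt_last i, hi, ?_, ?_, ?_⟩
    · rintro (h | ⟨s, hs, h⟩)
      · exact hW ((mem_fibre_iff h4 hF' h5).1 h)
      · have hs' : s < t + 1 := hs
        have := congrArg depth h
        rw [h6, (spec (by omega : s ≤ m)).2.2] at this
        exact hs'.ne (sweepDepth_inj (by omega) (by omega) this)
    -- The moving vertex is the largest, so no vertex has priority over it.
    · exact fun _ j' _ hj' => absurd (Fin.le_last j') (not_le.2 hj')
    · intro i' F₃ hi' hf₃ hF₃
      induction i' using Fin.lastCases with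
      | last => exact absurd hi' (lt_irrefl _)
      | cast i' =>
        obtain ⟨hR, hd⟩ := hf₃.restricts_last hG hF' h2
        have hle := hf₃.right.depth_le hR
        by_cases hds : depth F₃ = sweepDepth b m (t + 1)
        · exact hf₃.right.eq_insertAt hG hF' hR hds
        · exfalso
          -- The depth of `F₃` differs by one from that of `f t`, so `F₃` is the forest just left.
          -- At `t = 0` such a depth would be negative or exceed `m`.
          have hcase : 1 ≤ t ∧ depth F₃ = sweepDepth b m (t - 1) := by
            unfold sweepDepth at h3 hds ⊢
            split_ifs at h3 hds ⊢ <;> omega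
          refine hF₃ (Or.inr ⟨t - 1, ?_, (hf₃.right.eq_insertAt hG hF' hR hcase.2).symm⟩)
          exact Set.mem_Iio.2 (by omega)
  have := isGreedy_map_range' step m 0 (Nat.zero_add m)
  have e : Set.Iio 0 = (∅ : Set ℕ) := by
    ext x
    simp
  rw [e, Set.image_empty, Set.union_empty, ← List.range_eq_range'] at this
  exact this

/-- A greedy step lifts to forests in which the last vertex is extreme. -/
lemma IsStep.lift (hG : IsPEO G) {W : Set (Forest (Fin n))} {F' F₂' : Forest (Fin n)}
    (hW : F' ∈ W) (h : IsStep (G.comap Fin.castSucc) W F' F₂') (b : Bool) :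
    IsStep G (fibre G W) (insertAt G F' (endDepth G b F'))
      (insertAt G F₂' (endDepth G b F₂')) := by
  obtain ⟨i, j, hij, hf, hF₂, hgt, huniq⟩ := h
  have hle : ∀ F' : Forest (Fin n), endDepth G b F' ≤ maxDepth G F' := fun F' => by
    unfold endDepth
    split_ifs <;> simp
  obtain ⟨h1, h2, h3⟩ := insertAt_spec hG hf.left (hle F')
  obtain ⟨h4, h5, h6⟩ := insertAt_spec hG hf.right (hle F₂')
  have hb := (h1.isEnd_iff h2).2 h3
  have hb₂ := (h4.isEnd_iff h5).2 h6
  refine ⟨i.castSucc, j.castSucc, Fin.castSucc_lt_castSucc_iff.2 hij,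
    hf.castSucc h1 h4 h2 h5 hb hb₂, fun h => hF₂ ((mem_fibre_iff h4 hf.right h5).1 h), ?_, ?_⟩
  · intro i' j' F₃ hj' hi' hf₃
    induction i' using Fin.lastCases with
    | last => exact absurd (Fin.le_last j') (not_le.2 hi')
    | cast i' =>
      induction j' using Fin.lastCases with
      | last =>
        -- Rotating the last vertex stays over `F'`, and all forests over `F'` have been visited.
        obtain ⟨hR, -⟩ := hf₃.restricts_last hG hf.left h2
        exact (mem_fibre_iff hf₃.right hf.left hR).2 hW
      | cast j' =>
        obtain ⟨F₃', hF₃', hR₃⟩ := hf₃.right.exists_restricts hG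
        exact (mem_fibre_iff hf₃.right hF₃' hR₃).2 (hgt i' j' F₃'
          (Fin.castSucc_lt_castSucc_iff.1 hj') (Fin.castSucc_lt_castSucc_iff.1 hi')
          (hf₃.of_castSucc hf.left hF₃' h2 hR₃))
  · intro i' F₃ hi' hf₃ hF₃
    induction i' using Fin.lastCases with
    | last => exact absurd (Fin.le_last j.castSucc) (not_le.2 hi')
    | cast i' =>
      obtain ⟨F₃', hF₃', hR₃⟩ := hf₃.right.exists_restricts hG
      have e := huniq i' F₃' (Fin.castSucc_lt_castSucc_iff.1 hi')
        (hf₃.of_castSucc hf.left hF₃' h2 hR₃)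
        fun h => hF₃ ((mem_fibre_iff hf₃.right hF₃' hR₃).2 h)
      subst e
      -- A rotation of smaller vertices leaves the subtree of the last vertex alone, so that vertex
      -- remains at the same extreme position.
      exact hf₃.right.eq_insertAt hG hF₃' hR₃ ((hf₃.right.isEnd_iff hR₃).1 (hf₃.isEnd hb))

/-- Sweeping the last vertex alternately down and up through the forests of the list. -/
noncomputable def zigzag (G : SimpleGraph (Fin (n + 1))) :
    Bool → List (Forest (Fin n)) → List (Forest (Fin (n + 1)))
  | _, [] => []
  | b, F' :: L => sweep G b F' ++ zigzag G (!b) L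

lemma mem_zigzag (hG : IsPEO G) {b : Bool} {L : List (Forest (Fin n))}
    (hL : ∀ F' ∈ L, IsNested (G.comap Fin.castSucc) F') {F : Forest (Fin (n + 1))} :
    F ∈ zigzag G b L ↔ IsNested G F ∧ ∃ F' ∈ L, Restricts F F' := by
  induction L generalizing b with
  | nil => simp [zigzag]
  | cons F' L ih =>
    rw [zigzag, List.mem_append, mem_sweep hG (hL F' List.mem_cons_self),
      ih fun F'' h => hL F'' (List.mem_cons_of_mem _ h)]
    simp only [List.mem_cons, exists_eq_or_imp]
    tauto

/-- A sweep that starts at the end `b` finishes at the end `!b`, where the step to the next fibre is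
lifted and the next sweep starts. By then the fibre is exhausted, so the visited set is again of the
form `fibre G W`. -/
lemma isGreedy_zigzag (hG : IsPEO G) (b : Bool) {W : Set (Forest (Fin n))} {F' : Forest (Fin n)}
    {L : List (Forest (Fin n))} (hL : ∀ F'' ∈ F' :: L, IsNested (G.comap Fin.castSucc) F'')
    (h : IsGreedy (G.comap Fin.castSucc) W (F' :: L)) (hW : F' ∉ W) :
    IsGreedy G (fibre G W) (zigzag G b (F' :: L)) := by
  have hF' := hL F' List.mem_cons_self
  induction L generalizing b W F' with
  | nil =>
    rw [zigzag, zigzag, List.append_nil]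
    exact isGreedy_sweep hG b hF' hW
  | cons F₂' L ih =>
    obtain ⟨hs, h'⟩ := h
    have hF₂' := hL F₂' (by simp)
    have hrest := ih (!b) (fun F'' h => hL F'' (List.mem_cons_of_mem _ h)) h'
      (by obtain ⟨_, _, _, _, h, _⟩ := hs; exact h) hF₂'
    have hstep := hs.lift hG (Set.mem_insert _ _) (!b)
    have hsw := isGreedy_sweep hG b hF' hW
    rw [fibre_insert hG (b := b) hF'] at hrest hstep
    obtain ⟨A, hA⟩ := sweep_eq_concat (G := G) b F'
    obtain ⟨B, hB⟩ := sweep_eq_cons (G := G) (!b) F₂'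
    have e : zigzag G (!b) (F₂' :: L) =
        insertAt G F₂' (endDepth G (!b) F₂') :: (B ++ zigzag G (!!b) L) := by
      rw [zigzag, hB, List.cons_append]
    rw [zigzag, e, hA]
    rw [e, hA] at hrest
    rw [hA] at hstep hsw
    exact hsw.append hstep hrest

end Zigzag

/-- The greedy rule visits all elimination forests. -/
theorem exists_isGreedy {n : ℕ} {G : SimpleGraph (Fin n)} (hG : IsPEO G) :
    ∃ L, IsGreedy G ∅ (initialForest G :: L) ∧ ∀ F, F ∈ initialForest G :: L ↔ IsNested G F := by
  induction n with
  | zero =>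
    refine ⟨[], trivial, fun F => ?_⟩
    have : F = initialForest G := Subsingleton.elim _ _
    subst this
    simpa using (isNested_initialForest G).1
  | succ n ih =>
    obtain ⟨L', hL', hmem⟩ := ih hG.comap
    -- The value `false` because the last vertex is a leaf of the initial forest.
    have hzz := isGreedy_zigzag hG false (fun F' h => (hmem F').1 h) hL' (Set.notMem_empty _)
    obtain ⟨hR, hend⟩ := restricts_initialForest hG
    have hF₀ := (isNested_initialForest G).1
    have hF₀' := (isNested_initialForest (G.comap (Fin.castSucc (n := n)))).1
    obtain ⟨B, hB⟩ := sweep_eq_cons (G := G) false (initialForest (G.comap Fin.castSucc))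
    have e : zigzag G false (initialForest (G.comap Fin.castSucc) :: L') =
        initialForest G :: (B ++ zigzag G (!false) L') := by
      rw [zigzag, hB, List.cons_append, hF₀.eq_insertAt hG hF₀' hR ((hF₀.isEnd_iff hR).1 hend)]
    have hempty : fibre G (∅ : Set (Forest (Fin n))) = ∅ := by
      ext F
      simp [fibre]
    refine ⟨B ++ zigzag G (!false) L', ?_, fun F => ?_⟩
    · rw [← e, ← hempty]
      exact hzz
    · rw [← e, mem_zigzag hG fun F' h => (hmem F').1 h]
      refine ⟨And.left, fun hF => ⟨hF, ?_⟩⟩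
      obtain ⟨F', hF', hRF⟩ := hF.exists_restricts hG
      exact ⟨F', (hmem F').2 hF', hRF⟩

end Elim

/-- If the natural order of the vertices of `G` is a perfect elimination ordering, then Algorithm R,
started from the forest obtained by removing the vertices in increasing order, terminates, having
visited every elimination forest of `G` exactly once; consecutive forests differ by one rotation,
and the corresponding vertices form a Hamilton path on the graph associahedron. -/
theorem theorem1 (n : ℕ) (G : SimpleGraph (Fin n)) (hG : Elim.IsPEO G) :
    ∃ (k : ℕ) (L : List (Elim.Forest (Fin n))),
      L = Elim.algorithmR G (Elim.initialForest G) k ∧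
      Elim.nextForest G L = none ∧
      L.Nodup ∧
      (∀ F, F ∈ L ↔ Elim.IsElimForest G F) ∧
      L.IsChain (Elim.IsRotation G) ∧
      ∃ (a b : (Elim.graphAssociahedron G).extremePoints ℝ)
        (p : (Elim.skeleton (Elim.graphAssociahedron G)).Walk a b),
        p.IsHamiltonian ∧
        p.support.map Subtype.val = L.map (Elim.assocVertex G) := by
  obtain ⟨L, hL, hmem⟩ := Elim.exists_isGreedy hG
  have hnd := (hL.nodup (Set.notMem_empty _)).1
  have hempty : {x | x ∈ ([] : List (Elim.Forest (Fin n)))} = ∅ := by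
    ext x
    simp
  obtain ⟨k, hk⟩ := Elim.IsGreedy.exists_algorithmR (A := []) (hempty ▸ hL) (k := 0) rfl
  refine ⟨k, _, hk.symm, Elim.nextForest_eq_none hmem, hnd,
    fun F => (hmem F).trans Elim.isElimForest_iff.symm,
    hL.isChain.imp fun _ _ ⟨_, _, h⟩ => h.isRotation, ?_⟩
  exact Elim.exists_isHamiltonian (List.cons_ne_nil _ _) hnd hmem hL.isChain
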